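/- Let $(\Omega,\mathcal F,P)$ be a probability space, let $(\varepsilon_i)_{i\ge 1}$ be independent, square-integrable real random variables with $E(\varepsilon_i)=0$ and $E(\varepsilon_i^2)=1$ for all $i$, and let $b=(b_i)_{i\ge1}$ be a real sequence with $b\in\ell_2$. Assume that $P(\varepsilon_i>b_i)>0$ and $P(\varepsilon_i<b_i)>0$ for all $i\ge1$, and that $\sup_{i\ge1}E(|\varepsilon_i|^3)<\infty$. For $x\in\mathbb R$ and $h\in\ell_2$ let $V^{x,h}:=x+\sum_{i=1}^\infty h_i(\varepsilon_i-b_i)$, where the series is the limit in $L^2(P)$ of its partial sums. For a random variable $G$ let $$\pi(G):=\inf\{z\in\mathbb R:\ \text{there is } h\in\ell_2 \text{ with } V^{z,h}\ge G\ P\text{-a.s.}\}\in[-\infty,+\infty],$$ with $\inf\emptyset=+\infty$, and let $\mathcal M_2$ be the set of all probability measures $Q$ on $(\Omega,\mathcal F)$ that are equivalent to $P$ and satisfy $dQ/dP\in L^2(P)$ and $E_Q(\varepsilon_i)=b_i$ for all $i\ge1$. Then for every $G\in L^2(P)$ the expectation $E_Q(G)$ is well defined and finite for every $Q\in\mathcal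 M_2$, and $$\pi(G)=\sup_{Q\in\mathcal M_2}E_Q(G),$$ as an equality in $[-\infty,+\infty]$. -/

import Mathlib

open MeasureTheory ProbabilityTheory Filter Topology
open scoped ENNReal lp

namespace LargeMarket

/-- `V` is (a version of) the terminal portfolio value
`V^{x,h} = x + ∑ i, h i * (ε i - b i)`, the series being the limit in `L²(P)` of its
partial sums. -/
def IsTerminalValue {Ω : Type*} [MeasurableSpace Ω] (P : Measure Ω) (ε : ℕ → Ω → ℝ)
    (b : ℕ → ℝ) (x : ℝ) (h : ℓ²(ℕ, ℝ)) (V : Ω → ℝ) : Prop :=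
  MemLp V 2 P ∧
    Tendsto (fun n : ℕ => eLpNorm
      (fun ω => (x + ∑ i ∈ Finset.range n, h i * (ε i ω - b i)) - V ω) 2 P) atTop (𝓝 0)

/-- The set `𝒜(G, x)` of the strategies `h ∈ ℓ₂` with `V^{x,h} ≥ G` almost surely. -/
def superreplicating {Ω : Type*} [MeasurableSpace Ω] (P : Measure Ω) (ε : ℕ → Ω → ℝ)
    (b : ℕ → ℝ) (G : Ω → ℝ) (x : ℝ) : Set ℓ²(ℕ, ℝ) :=
  {h | ∃ V : Ω → ℝ, IsTerminalValue P ε b x h V ∧ ∀ᵐ ω ∂P, G ω ≤ V ω}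

/-- The superreplication price `π(G) = inf {z ∈ ℝ : 𝒜(G, z) ≠ ∅}`, an extended real number
(`+∞` if no initial capital suffices). -/
noncomputable def superreplicationPrice {Ω : Type*} [MeasurableSpace Ω] (P : Measure Ω)
    (ε : ℕ → Ω → ℝ) (b : ℕ → ℝ) (G : Ω → ℝ) : EReal :=
  sInf ((fun z : ℝ => (z : EReal)) '' {z : ℝ | (superreplicating P ε b G z).Nonempty})

/-- The set `ℳ₂` of the probability measures `Q ∼ P` with `dQ/dP ∈ L²(P)` and
`E_Q (ε i) = b i` for all `i`. -/
def martingaleMeasures {Ω : Type*} [MeasurableSpace Ω] (P : Measure Ω) (ε : ℕ → Ω → ℝ)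
    (b : ℕ → ℝ) : Set (Measure Ω) :=
  {Q | IsProbabilityMeasure Q ∧ Q ≪ P ∧ P ≪ Q ∧
    MemLp (fun ω => (Q.rnDeriv P ω).toReal) 2 P ∧
    ∀ i, Integrable (ε i) Q ∧ (∫ ω, ε i ω ∂Q) = b i}

end LargeMarket

namespace LargeMarket

/-! Write `T h` for the gain `∑ h i (ε i - b i)` in `L²`. The density of any `Q ∈ ℳ₂` is a
non-negative element of `L²` orthogonal to all gains, so pairing it with `G - x ≤ T h` gives `E_Q G
≤ x`. Conversely, if `x` does not superreplicate, `G - x` lies outside the convex cone of elements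
dominated by a gain. Once that cone is closed, Hahn–Banach yields a non-negative functional that
kills the gains and is positive on `G - x`. It may vanish on a set of positive measure; adding a
small multiple of a strictly positive pricing density `W` and normalising gives a measure in `ℳ₂`
with `E_Q G > x`.

`W` is an infinite product of densities `f i (ε i)`, each moving the mean of `ε i` to `b i`. For
small `b i` the uniform third moment bound makes the second and inverse moments cost only `O(b i ^
2)`. As `b ∈ ℓ₂`, the products converge in `L²`, and Fatou gives `E[1/W] < ∞`
(`exists_product_density`).

Closedness (`isClosed_dominated`) rests on the coercivity `c ‖h‖ ≤ ‖(T h)⁻‖`. Under `W` gains and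
losses balance. A portfolio with `‖h‖ = 1` has second moment at least one and bounded third moment,
so it cannot be concentrated near zero, and `E[1/W] < ∞` prevents `W` from being negligible where it
is large (`exists_loss_bound`). -/

theorem integrable_of_bounded {Ω : Type*} [MeasurableSpace Ω] {P : Measure Ω}
    [IsFiniteMeasure P] {g : Ω → ℝ} (hg : Measurable g) (c : ℝ) (h : ∀ ω, |g ω| ≤ c) :
    Integrable g P :=
  Integrable.of_bound hg.aestronglyMeasurable c (Eventually.of_forall h)

/-! ### One-dimensional changes of measure -/

/-- A two-valued change of measure that moves the mean of `X` to a point `b` which splits the law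
of `X`. -/
theorem exists_density_of_split {Ω : Type*} [MeasurableSpace Ω] {P : Measure Ω}
    [IsProbabilityMeasure P] {X : Ω → ℝ} (hX : Measurable X) (hint : Integrable X P) {b : ℝ}
    (hup : 0 < P {ω | b < X ω}) (hdown : 0 < P {ω | X ω < b}) :
    ∃ f : ℝ → ℝ, Measurable f ∧ (∃ l u : ℝ, 0 < l ∧ ∀ x, l ≤ f x ∧ f x ≤ u) ∧
      (∫ ω, f (X ω) ∂P) = 1 ∧ (∫ ω, f (X ω) * X ω ∂P) = b := by
  have hY : Integrable (fun ω => X ω - b) P := hint.sub (integrable_const b)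
  have hpos : Integrable (fun ω => max (X ω - b) 0) P := hY.pos_part
  have hneg : Integrable (fun ω => max (-(X ω - b)) 0) P := hY.neg_part
  set p := ∫ ω, max (X ω - b) 0 ∂P with hp
  set q := ∫ ω, max (-(X ω - b)) 0 ∂P with hq
  have hp0 : 0 < p := by
    rw [hp, integral_pos_iff_support_of_nonneg (f := fun ω => max (X ω - b) 0)
      (fun ω => le_max_right _ _) hpos]
    refine hup.trans_le (measure_mono fun ω (hω : b < X ω) => ?_)
    simp only [Function.mem_support]
    exact (lt_max_of_lt_left (sub_pos.2 hω)).ne'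
  have hq0 : 0 < q := by
    rw [hq, integral_pos_iff_support_of_nonneg (f := fun ω => max (-(X ω - b)) 0)
      (fun ω => le_max_right _ _) hneg]
    refine hdown.trans_le (measure_mono fun ω (hω : X ω < b) => ?_)
    simp only [Function.mem_support]
    exact (lt_max_of_lt_left (by linarith)).ne'
  -- The weights are crossed: the upper part of `X - b` has mean `p` and gets weight `q`, the lower
  -- part has mean `q` and gets weight `p`, so the two contributions cancel.
  set f₀ : ℝ → ℝ := fun x => if b < x then q else p with hf₀
  have hf₀m : Measurable f₀ := Measurable.ite measurableSet_Ioi measurable_const measurable_const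
  have hf₀l : ∀ x, min p q ≤ f₀ x := fun x => by
    simp only [hf₀]; split_ifs <;> simp
  have hf₀u : ∀ x, f₀ x ≤ max p q := fun x => by
    simp only [hf₀]; split_ifs <;> simp
  have hm : 0 < min p q := lt_min hp0 hq0
  have hbd : ∀ x, |f₀ x| ≤ max p q := fun x => by
    rw [abs_of_pos (hm.trans_le (hf₀l x))]; exact hf₀u x
  have hf₀i : Integrable (fun ω => f₀ (X ω)) P :=
    integrable_of_bounded (hf₀m.comp hX) _ fun ω => hbd _
  set N := ∫ ω, f₀ (X ω) ∂P with hN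
  have hN0 : 0 < N := by
    have : ∫ _ω, min p q ∂P ≤ N := integral_mono (integrable_const _) hf₀i fun ω => hf₀l _
    simp at this
    rcases this with h | h <;> linarith
  have hprod : Integrable (fun ω => f₀ (X ω) * X ω) P :=
    hint.bdd_mul (hf₀m.comp hX).aestronglyMeasurable (Eventually.of_forall fun ω => hbd (X ω))
  have hzero : ∫ ω, f₀ (X ω) * (X ω - b) ∂P = 0 := by
    have : (fun ω => f₀ (X ω) * (X ω - b)) =
        fun ω => q * max (X ω - b) 0 - p * max (-(X ω - b)) 0 := by
      funext ω
      simp only [hf₀]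
      split_ifs with h
      · rw [max_eq_left (by linarith), max_eq_right (by linarith)]; ring
      · rw [max_eq_right (by linarith), max_eq_left (by linarith)]; ring
    rw [this, integral_sub (hpos.const_mul _) (hneg.const_mul _), integral_const_mul,
      integral_const_mul, ← hp, ← hq]
    ring
  have hfX : ∫ ω, f₀ (X ω) * X ω ∂P = b * N := by
    have : (fun ω => f₀ (X ω) * (X ω - b)) = fun ω => f₀ (X ω) * X ω - b * f₀ (X ω) := by
      funext ω; ring
    rw [this, integral_sub hprod (hf₀i.const_mul _), integral_const_mul] at hzero
    linarith
  refine ⟨fun x => f₀ x / N, hf₀m.div_const _, ⟨min p q / N, max p q / N, div_pos hm hN0,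
    fun x => ⟨div_le_div_of_nonneg_right (hf₀l x) hN0.le,
      div_le_div_of_nonneg_right (hf₀u x) hN0.le⟩⟩, ?_, ?_⟩
  · rw [integral_div, ← hN, div_self hN0.ne']
  · simp_rw [div_mul_eq_mul_div]
    rw [integral_div, hfX, mul_div_assoc, div_self hN0.ne', mul_one]

/-- If `X` is centred with unit variance, a small shift of its mean is realised by a density whose
second moment and inverse moment exceed one by a multiple of the squared shift. -/
theorem exists_density_of_small {Ω : Type*} [MeasurableSpace Ω] {P : Measure Ω}
    [IsProbabilityMeasure P] {X : Ω → ℝ} (hX : Measurable X) (hsq : MemLp X 2 P)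
    (hmean : ∫ ω, X ω ∂P = 0) (hvar : ∫ ω, X ω ^ 2 ∂P = 1) {C b : ℝ} (hC : 1 ≤ C)
    (hint3 : Integrable (fun ω => |X ω| ^ 3) P) (hthird : ∫ ω, |X ω| ^ 3 ∂P ≤ C)
    (hb : 16 * C * |b| ≤ 1) :
    ∃ f : ℝ → ℝ, Measurable f ∧ (∃ l u : ℝ, 0 < l ∧ ∀ x, l ≤ f x ∧ f x ≤ u) ∧
      (∫ ω, f (X ω) ∂P) = 1 ∧ (∫ ω, f (X ω) * X ω ∂P) = b ∧
      (∫ ω, f (X ω) ^ 2 ∂P) ≤ 1 + 128 * C ^ 2 * b ^ 2 ∧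
      (∫ ω, (f (X ω))⁻¹ ∂P) ≤ 1 + 128 * C ^ 2 * b ^ 2 := by
  have hint : Integrable X P := hsq.integrable one_le_two
  have hint2 : Integrable (fun ω => X ω ^ 2) P := hsq.integrable_sq
  -- Truncating at `2 * C` costs at most `E|X|³ / (2C) ≤ 1/2` of the unit variance, so `A ≥ 1/2`.
  -- Then `g = (φ - m) / A` is bounded by `8 * C`, has mean zero and covariance one with `X`, and
  -- the density is `1 + b * g`.
  set φ : ℝ → ℝ := fun x => max (-(2 * C)) (min (2 * C) x) with hφ
  have hφm : Measurable φ := by fun_prop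
  have hφb : ∀ x, |φ x| ≤ 2 * C := fun x => by
    rw [abs_le]
    exact ⟨le_max_left _ _, max_le (by linarith) (min_le_left _ _)⟩
  have hφi : Integrable (fun ω => φ (X ω)) P :=
    integrable_of_bounded (hφm.comp hX) _ fun ω => hφb _
  have hφXi : Integrable (fun ω => φ (X ω) * X ω) P :=
    hint.bdd_mul (hφm.comp hX).aestronglyMeasurable (Eventually.of_forall fun ω => hφb (X ω))
  set m := ∫ ω, φ (X ω) ∂P with hm
  set A := ∫ ω, φ (X ω) * X ω ∂P with hA
  have hmb : |m| ≤ 2 * C := by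
    have := norm_integral_le_of_norm_le_const (μ := P) (f := fun ω => φ (X ω)) (C := 2 * C)
      (Eventually.of_forall fun ω => hφb (X ω))
    simpa using this
  have hpt : ∀ x : ℝ, x ^ 2 - |x| ^ 3 / (2 * C) ≤ φ x * x := fun x => by
    have h3 : 0 ≤ |x| ^ 3 / (2 * C) := by positivity
    by_cases h : |x| ≤ 2 * C
    · have h' := abs_le.1 h
      simp only [hφ]
      rw [min_eq_right h'.2, max_eq_right h'.1]
      nlinarith
    · push Not at h
      have h0 : x ^ 2 ≤ |x| ^ 3 / (2 * C) := by
        rw [le_div_iff₀ (by linarith), ← sq_abs]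
        nlinarith [sq_nonneg |x|]
      have h1 : 0 ≤ φ x * x := by
        rcases le_total 0 x with hx | hx
        · exact mul_nonneg (le_max_of_le_right (le_min (by linarith) hx)) hx
        · exact mul_nonneg_of_nonpos_of_nonpos
            (max_le (by linarith) ((min_le_right _ _).trans hx)) hx
      linarith
  have hA2 : 1 / 2 ≤ A := by
    have h := integral_mono (hint2.sub (hint3.div_const (2 * C))) hφXi fun ω => hpt (X ω)
    simp only [Pi.sub_apply] at h
    rw [integral_sub hint2 (hint3.div_const _), integral_div, hvar] at h
    have : (∫ ω, |X ω| ^ 3 ∂P) / (2 * C) ≤ 1 / 2 := by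
      rw [div_le_iff₀ (by linarith)]; linarith
    linarith
  set g : ℝ → ℝ := fun x => (φ x - m) / A with hg
  have hgm : Measurable g := (hφm.sub_const _).div_const _
  have hgb : ∀ x, |g x| ≤ 8 * C := fun x => by
    simp only [hg]
    rw [abs_div, abs_of_pos (by linarith : 0 < A), div_le_iff₀ (by linarith)]
    have := abs_sub (φ x) m
    have := hφb x
    nlinarith
  have hgi : Integrable (fun ω => g (X ω)) P :=
    integrable_of_bounded (hgm.comp hX) _ fun ω => hgb _
  have hgXi : Integrable (fun ω => g (X ω) * X ω) P :=
    hint.bdd_mul (hgm.comp hX).aestronglyMeasurable (Eventually.of_forall fun ω => hgb (X ω))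
  have hg0 : ∫ ω, g (X ω) ∂P = 0 := by
    simp only [hg]
    rw [integral_div, integral_sub hφi (integrable_const _)]
    simp [← hm]
  have hg1 : ∫ ω, g (X ω) * X ω ∂P = 1 := by
    have : (fun ω => g (X ω) * X ω) = fun ω => (φ (X ω) * X ω - m * X ω) / A := by
      funext ω; simp only [hg]; ring
    rw [this, integral_div, integral_sub hφXi (hint.const_mul _), integral_const_mul, hmean,
      ← hA, mul_zero, sub_zero, div_self (by linarith)]
  have hbg : ∀ x, |b * g x| ≤ 1 / 2 := fun x => by
    rw [abs_mul]
    have := hgb x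
    have := abs_nonneg b
    nlinarith
  have hbg2 : ∀ x, (b * g x) ^ 2 ≤ 64 * C ^ 2 * b ^ 2 := fun x => by
    have h := pow_le_pow_left₀ (abs_nonneg _) (hgb x) 2
    rw [sq_abs] at h
    nlinarith [sq_nonneg b]
  have hbgi : Integrable (fun ω => b * g (X ω)) P := hgi.const_mul _
  have hfi : Integrable (fun ω => 1 + b * g (X ω)) P := (integrable_const 1).add hbgi
  have hmaj : Integrable (fun ω => (1 + 128 * C ^ 2 * b ^ 2) + 2 * (b * g (X ω))) P :=
    (integrable_const _).add (hbgi.const_mul _)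
  have hmaj' : Integrable (fun ω => (1 + 128 * C ^ 2 * b ^ 2) - b * g (X ω)) P :=
    (integrable_const _).sub hbgi
  refine ⟨fun x => 1 + b * g x, measurable_const.add (hgm.const_mul b), ⟨1 / 2, 3 / 2, by norm_num,
    fun x => ?_⟩, ?_, ?_, ?_, ?_⟩
  · have := abs_le.1 (hbg x)
    constructor <;> linarith
  · rw [integral_add (integrable_const _) hbgi, integral_const_mul, hg0]; simp
  · have : (fun ω => (1 + b * g (X ω)) * X ω) = fun ω => X ω + b * (g (X ω) * X ω) := by
      funext ω; ring
    rw [this, integral_add hint (hgXi.const_mul _), integral_const_mul, hg1, hmean]; ring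
  · calc _ ≤ ∫ ω, ((1 + 128 * C ^ 2 * b ^ 2) + 2 * (b * g (X ω))) ∂P := by
          refine integral_mono_of_nonneg (Eventually.of_forall fun ω => sq_nonneg _) hmaj
            (Eventually.of_forall fun ω => ?_)
          have := hbg2 (X ω)
          have : 0 ≤ C ^ 2 * b ^ 2 := by positivity
          simp only
          nlinarith
      _ = _ := by
          rw [integral_add (integrable_const _) (hbgi.const_mul _), integral_const_mul,
            integral_const_mul, hg0]
          simp
  -- For `t ≥ -1/2` one has `1 / (1 + t) ≤ 1 - t + 2 * t ^ 2`, because `(1 + t)(1 - t + 2t²) = 1 +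
  -- t²(1 + 2t)`. With `t = b * g` the linear term integrates to zero, and `2 * 64 = 128`.
  · calc _ ≤ ∫ ω, ((1 + 128 * C ^ 2 * b ^ 2) - b * g (X ω)) ∂P := by
          have hlow : ∀ ω, 1 / 2 ≤ 1 + b * g (X ω) := fun ω => by
            linarith [(abs_le.1 (hbg (X ω))).1]
          refine integral_mono_of_nonneg (Eventually.of_forall fun ω =>
            inv_nonneg.2 (by linarith [hlow ω])) hmaj' (Eventually.of_forall fun ω => ?_)
          have h2 := hbg2 (X ω)
          have h1 := hlow ω
          simp only
          rw [inv_le_iff_one_le_mul₀ (by linarith)]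
          generalize b * g (X ω) = t at *
          nlinarith [mul_nonneg (by positivity : 0 ≤ C ^ 2 * b ^ 2) (by linarith : 0 ≤ 1 + 2 * t)]
      _ = _ := by
          rw [integral_sub (integrable_const _) hbgi, integral_const_mul, hg0]
          simp

/-! ### Inner products in `L²` -/

theorem sq_norm_Lp {Ω : Type*} [MeasurableSpace Ω] {P : Measure Ω} (F : Lp ℝ 2 P) :
    ‖F‖ ^ 2 = ∫ ω, F ω ^ 2 ∂P := by
  rw [← real_inner_self_eq_norm_sq, L2.inner_def]
  simp [sq]

theorem inner_Lp {Ω : Type*} [MeasurableSpace Ω] {P : Measure Ω} (F G : Lp ℝ 2 P) :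
    inner ℝ F G = ∫ ω, F ω * G ω ∂P := by
  rw [L2.inner_def]
  simp [mul_comm]

theorem inner_toLp {Ω : Type*} [MeasurableSpace Ω] {P : Measure Ω} {f g : Ω → ℝ}
    (hf : MemLp f 2 P) (hg : MemLp g 2 P) :
    inner ℝ (hf.toLp f) (hg.toLp g) = ∫ ω, f ω * g ω ∂P := by
  rw [inner_Lp]
  refine integral_congr_ae ?_
  filter_upwards [hf.coeFn_toLp, hg.coeFn_toLp] with ω h1 h2
  rw [h1, h2]

theorem inner_Lp_toLp {Ω : Type*} [MeasurableSpace Ω] {P : Measure Ω} {g : Ω → ℝ}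
    (F : Lp ℝ 2 P) (hg : MemLp g 2 P) :
    inner ℝ F (hg.toLp g) = ∫ ω, F ω * g ω ∂P := by
  rw [inner_Lp]
  refine integral_congr_ae ?_
  filter_upwards [hg.coeFn_toLp] with ω h2
  rw [h2]

/-! ### Infinite products of independent densities -/

theorem integral_prod_range {Ω : Type*} [MeasurableSpace Ω] {P : Measure Ω} {ε : ℕ → Ω → ℝ}
    (hmeas : ∀ i, Measurable (ε i)) (hindep : iIndepFun ε P) {g : ℕ → ℝ → ℝ}
    (hg : ∀ i, Measurable (g i)) (n : ℕ) :
    ∫ ω, ∏ i ∈ Finset.range n, g i (ε i ω) ∂P =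
      ∏ i ∈ Finset.range n, ∫ ω, g i (ε i ω) ∂P := by
  have h : iIndepFun (fun i : Fin n => ε i) P := hindep.precomp Fin.val_injective
  simp_rw [Finset.prod_range]
  exact h.integral_fun_prod_comp (f := fun i : Fin n => g i) (fun i => (hmeas i).aemeasurable)
    fun i => (hg i).aestronglyMeasurable

theorem prod_range_ite_lt (x : ℕ → ℝ) {n m : ℕ} (hnm : n ≤ m) :
    ∏ j ∈ Finset.range m, (if j < n then x j else 1) = ∏ j ∈ Finset.range n, x j := by
  rw [← Finset.prod_filter]
  congr 1
  ext j
  simp only [Finset.mem_filter, Finset.mem_range]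
  omega

theorem prod_range_le_exp {x a : ℕ → ℝ} (hx : ∀ i, 0 ≤ x i) (hxa : ∀ i, x i ≤ 1 + a i)
    (ha : ∀ i, 0 ≤ a i) (hs : Summable a) (n : ℕ) :
    ∏ i ∈ Finset.range n, x i ≤ Real.exp (∑' i, a i) :=
  calc ∏ i ∈ Finset.range n, x i ≤ ∏ i ∈ Finset.range n, Real.exp (a i) :=
        Finset.prod_le_prod (fun i _ => hx i) fun i _ =>
          (hxa i).trans (by linarith [Real.add_one_le_exp (a i)])
    _ = Real.exp (∑ i ∈ Finset.range n, a i) := (Real.exp_sum _ _).symm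
    _ ≤ _ := Real.exp_le_exp.2 (hs.sum_le_tsum _ fun i _ => ha i)

/-- Infinite product of independent one-dimensional changes of measure. -/
theorem exists_product_density {Ω : Type*} [MeasurableSpace Ω] {P : Measure Ω}
    [IsProbabilityMeasure P] {ε : ℕ → Ω → ℝ} {b : ℕ → ℝ}
    (hmeas : ∀ i, Measurable (ε i)) (hindep : iIndepFun ε P) (hsq : ∀ i, MemLp (ε i) 2 P)
    {f : ℕ → ℝ → ℝ} {a : ℕ → ℝ} (hfm : ∀ i, Measurable (f i))
    (hfb : ∀ i, ∃ l u : ℝ, 0 < l ∧ ∀ x, l ≤ f i x ∧ f i x ≤ u)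
    (hf1 : ∀ i, ∫ ω, f i (ε i ω) ∂P = 1) (hfε : ∀ i, ∫ ω, f i (ε i ω) * ε i ω ∂P = b i)
    (ha : ∀ i, 0 ≤ a i) (hs : Summable a) (hf2 : ∀ i, ∫ ω, f i (ε i ω) ^ 2 ∂P ≤ 1 + a i)
    (hfi : ∀ i, ∫ ω, (f i (ε i ω))⁻¹ ∂P ≤ 1 + a i) :
    ∃ W : Ω → ℝ, MemLp W 2 P ∧ (∀ᵐ ω ∂P, 0 < W ω) ∧ Integrable (fun ω => (W ω)⁻¹) P ∧
      ∀ i, ∫ ω, W ω * (ε i ω - b i) ∂P = 0 := by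
  choose l u hl hlu using hfb
  have hfpos : ∀ i x, 0 < f i x := fun i x => (hl i).trans_le (hlu i x).1
  have hfabs : ∀ i x, |f i x| ≤ u i := fun i x => by
    rw [abs_of_pos (hfpos i x)]; exact (hlu i x).2
  have hfint : ∀ i, Integrable (fun ω => f i (ε i ω)) P := fun i =>
    integrable_of_bounded ((hfm i).comp (hmeas i)) _ fun ω => hfabs _ _
  have hf2int : ∀ i, Integrable (fun ω => f i (ε i ω) ^ 2) P := fun i =>
    integrable_of_bounded (((hfm i).comp (hmeas i)).pow_const 2) (u i ^ 2) fun ω => by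
      rw [abs_pow]; exact pow_le_pow_left₀ (abs_nonneg _) (hfabs _ _) 2
  have hs1 : ∀ i, 1 ≤ ∫ ω, f i (ε i ω) ^ 2 ∂P := fun i => by
    have h : ∫ ω, (2 * f i (ε i ω) - 1) ∂P ≤ ∫ ω, f i (ε i ω) ^ 2 ∂P :=
      integral_mono (((hfint i).const_mul 2).sub (integrable_const 1)) (hf2int i) fun ω => by
        nlinarith [sq_nonneg (f i (ε i ω) - 1)]
    rw [integral_sub ((hfint i).const_mul 2) (integrable_const 1), integral_const_mul, hf1] at h
    simp at h
    linarith
  set Z : ℕ → Ω → ℝ := fun n ω => ∏ i ∈ Finset.range n, f i (ε i ω) with hZ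
  have hZm : ∀ n, Measurable (Z n) := fun n =>
    Finset.measurable_prod _ fun i _ => (hfm i).comp (hmeas i)
  have hZpos : ∀ n ω, 0 < Z n ω := fun n ω => Finset.prod_pos fun i _ => hfpos _ _
  have hZ2 : ∀ n, MemLp (Z n) 2 P := fun n =>
    MemLp.of_bound (hZm n).aestronglyMeasurable (∏ i ∈ Finset.range n, u i) (Eventually.of_forall
      fun ω => by
        rw [Real.norm_eq_abs, abs_of_pos (hZpos n ω)]
        exact Finset.prod_le_prod (fun i _ => (hfpos _ _).le) fun i _ => (hlu i _).2)
  set q : ℕ → ℝ := fun n => ∏ i ∈ Finset.range n, ∫ ω, f i (ε i ω) ^ 2 ∂P with hq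
  -- The martingale property of the products: factors with index at least `n` have mean one and drop
  -- out. Hence increments are orthogonal, and convergence in `L²` reduces to convergence of the
  -- bounded monotone sequence `q`.
  have hZZ : ∀ {n m : ℕ}, n ≤ m → ∫ ω, Z m ω * Z n ω ∂P = q n := fun {n m} hnm => by
    have h := integral_prod_range hmeas hindep
      (g := fun i x => f i x * (if i < n then f i x else 1)) (fun i => by
        by_cases hi : i < n
        · simp only [if_pos hi]; exact (hfm i).mul (hfm i)
        · simpa [hi] using hfm i) m
    have h1 : ∀ ω, ∏ i ∈ Finset.range m, (f i (ε i ω) * (if i < n then f i (ε i ω) else 1)) =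
        Z m ω * Z n ω := fun ω => by
      rw [Finset.prod_mul_distrib, prod_range_ite_lt _ hnm]
    simp_rw [h1] at h
    rw [h]
    simp only [hq]
    rw [← prod_range_ite_lt _ hnm]
    refine Finset.prod_congr rfl fun i _ => ?_
    by_cases hi : i < n
    · simp [hi, sq]
    · simp [hi, hf1]
  have hqmono : Monotone q := monotone_nat_of_le_succ fun n => by
    have h0 : 0 ≤ q n := Finset.prod_nonneg fun i _ => zero_le_one.trans (hs1 i)
    simp only [hq, Finset.prod_range_succ] at h0 ⊢
    exact le_mul_of_one_le_right h0 (hs1 n)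
  have hqbdd : BddAbove (Set.range q) := ⟨Real.exp (∑' i, a i), by
    rintro _ ⟨n, rfl⟩
    exact prod_range_le_exp (fun i => zero_le_one.trans (hs1 i)) hf2 ha hs n⟩
  set z : ℕ → Lp ℝ 2 P := fun n => (hZ2 n).toLp (Z n) with hz
  have hdist : ∀ {n m : ℕ}, n ≤ m → ‖z m - z n‖ ^ 2 = q m - q n := fun {n m} hnm => by
    rw [norm_sub_sq_real, ← real_inner_self_eq_norm_sq, ← real_inner_self_eq_norm_sq]
    simp only [hz, inner_toLp]
    rw [hZZ le_rfl, hZZ le_rfl, hZZ hnm]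
    ring
  have hcau : CauchySeq z := by
    rw [Metric.cauchySeq_iff']
    intro δ hδ
    obtain ⟨N, hN⟩ := Metric.cauchySeq_iff'.1
      (tendsto_atTop_ciSup hqmono hqbdd).cauchySeq (δ ^ 2) (by positivity)
    refine ⟨N, fun n hn => ?_⟩
    have h := hN n hn
    rw [Real.dist_eq] at h
    rw [dist_eq_norm]
    refine lt_of_pow_lt_pow_left₀ 2 hδ.le ?_
    rw [hdist hn]
    exact (le_abs_self _).trans_lt h
  obtain ⟨W, hW⟩ := cauchySeq_tendsto_of_complete hcau
  obtain ⟨φ, hφ, hφW⟩ := (tendstoInMeasure_of_tendsto_Lp hW).exists_seq_tendsto_ae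
  have hae : ∀ᵐ ω ∂P, Tendsto (fun n => Z (φ n) ω) atTop (𝓝 (W ω)) := by
    have h : ∀ᵐ ω ∂P, ∀ n, z n ω = Z n ω := ae_all_iff.2 fun n => (hZ2 n).coeFn_toLp
    filter_upwards [hφW, h] with ω h1 h2
    simpa only [h2] using h1
  have hinv : ∀ n, ∫⁻ ω, (ENNReal.ofReal (Z n ω))⁻¹ ∂P ≤
      ENNReal.ofReal (Real.exp (∑' i, a i)) := fun n => by
    have h := integral_prod_range hmeas hindep (g := fun i x => (f i x)⁻¹)
      (fun i => (hfm i).inv) n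
    simp_rw [Finset.prod_inv_distrib] at h
    have hle := prod_range_le_exp
      (fun i => integral_nonneg fun ω => (inv_pos.2 (hfpos i (ε i ω))).le) hfi ha hs n
    rw [← h] at hle
    have hb : ∀ ω, (Z n ω)⁻¹ ≤ ∏ i ∈ Finset.range n, (l i)⁻¹ := fun ω => by
      rw [hZ, ← Finset.prod_inv_distrib]
      exact Finset.prod_le_prod (fun i _ => (inv_pos.2 (hfpos _ _)).le) fun i _ =>
        inv_anti₀ (hl i) (hlu i _).1
    have hint : Integrable (fun ω => (Z n ω)⁻¹) P :=
      integrable_of_bounded (hZm n).inv _ fun ω => by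
        rw [abs_of_pos (inv_pos.2 (hZpos n ω))]; exact hb ω
    calc ∫⁻ ω, (ENNReal.ofReal (Z n ω))⁻¹ ∂P = ∫⁻ ω, ENNReal.ofReal ((Z n ω)⁻¹) ∂P :=
          lintegral_congr fun ω => (ENNReal.ofReal_inv_of_pos (hZpos n ω)).symm
      _ = ENNReal.ofReal (∫ ω, (Z n ω)⁻¹ ∂P) :=
          (ofReal_integral_eq_lintegral_ofReal hint (Eventually.of_forall fun ω =>
            (inv_pos.2 (hZpos n ω)).le)).symm
      _ ≤ _ := ENNReal.ofReal_le_ofReal hle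
  have hWm : Measurable fun ω => (ENNReal.ofReal (W ω))⁻¹ :=
    (Lp.stronglyMeasurable W).measurable.ennreal_ofReal.inv
  have hfatou : ∫⁻ ω, (ENNReal.ofReal (W ω))⁻¹ ∂P < ∞ := by
    calc ∫⁻ ω, (ENNReal.ofReal (W ω))⁻¹ ∂P
        = ∫⁻ ω, liminf (fun n => (ENNReal.ofReal (Z (φ n) ω))⁻¹) atTop ∂P := by
          refine lintegral_congr_ae ?_
          filter_upwards [hae] with ω h
          exact ((tendsto_inv_iff.2 ((ENNReal.continuous_ofReal.tendsto _).comp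
            h)).liminf_eq).symm
      _ ≤ liminf (fun n => ∫⁻ ω, (ENNReal.ofReal (Z (φ n) ω))⁻¹ ∂P) atTop :=
          lintegral_liminf_le fun n => (hZm _).ennreal_ofReal.inv
      _ ≤ liminf (fun _ : ℕ => ENNReal.ofReal (Real.exp (∑' i, a i))) atTop :=
          liminf_le_liminf (Eventually.of_forall fun n => hinv _)
      _ < ∞ := by rw [liminf_const]; exact ENNReal.ofReal_lt_top
  -- Strict positivity is a by-product of Fatou: `(ENNReal.ofReal w)⁻¹` is infinite when `w ≤ 0`.
  have hWpos : ∀ᵐ ω ∂P, 0 < W ω := by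
    filter_upwards [ae_lt_top hWm hfatou.ne] with ω h
    by_contra hn
    rw [ENNReal.ofReal_of_nonpos (not_lt.1 hn)] at h
    simp at h
  refine ⟨W, Lp.memLp W, hWpos, ⟨(Lp.stronglyMeasurable W).measurable.inv.aestronglyMeasurable,
    ?_⟩, fun i => ?_⟩
  · rw [hasFiniteIntegral_iff_enorm]
    refine lt_of_eq_of_lt (lintegral_congr_ae ?_) hfatou
    filter_upwards [hWpos] with ω h
    rw [← ENNReal.ofReal_inv_of_pos h, Real.enorm_of_nonneg (inv_pos.2 h).le]
  · have hY : MemLp (fun ω => ε i ω - b i) 2 P := (hsq i).sub (memLp_const _)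
    rw [← inner_Lp_toLp W hY]
    have hlim : Tendsto (fun n => inner ℝ (z n) (hY.toLp _)) atTop
        (𝓝 (inner ℝ W (hY.toLp _))) := hW.inner tendsto_const_nhds
    -- As soon as `n > i`, the pairing with `Z n` contains the factor `E[f i (ε i) (ε i - b i)] =
    -- 0`, so the sequence is eventually zero.
    refine tendsto_nhds_unique hlim (tendsto_const_nhds.congr' ?_)
    filter_upwards [eventually_gt_atTop i] with n hn
    simp only [hz, inner_toLp]
    have h := integral_prod_range hmeas hindep
      (g := fun j x => f j x * (if j = i then x - b i else 1)) (fun j => by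
        by_cases hj : j = i
        · simp only [if_pos hj]; exact (hfm j).mul (measurable_id.sub_const (b i))
        · simpa [hj] using hfm j) n
    have h1 : ∀ ω, ∏ j ∈ Finset.range n, (f j (ε j ω) * (if j = i then ε j ω - b i else 1)) =
        Z n ω * (ε i ω - b i) := fun ω => by
      rw [Finset.prod_mul_distrib, Finset.prod_ite_eq' _ i, if_pos (Finset.mem_range.2 hn)]
    simp_rw [h1] at h
    rw [h]
    refine (Finset.prod_eq_zero (Finset.mem_range.2 hn) ?_).symm
    have hfεi : Integrable (fun ω => f i (ε i ω) * ε i ω) P :=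
      ((hsq i).integrable one_le_two).bdd_mul ((hfm i).comp (hmeas i)).aestronglyMeasurable
        (Eventually.of_forall fun ω => hfabs i (ε i ω))
    simp only [if_true, mul_sub]
    rw [integral_sub hfεi ((hfint i).mul_const _), hfε, integral_mul_const, hf1]
    ring

/-- The market has a square-integrable, strictly positive pricing density. -/
theorem exists_pricing_density {Ω : Type*} [MeasurableSpace Ω] {P : Measure Ω}
    [IsProbabilityMeasure P] {ε : ℕ → Ω → ℝ} {b : ℕ → ℝ}
    (hmeas : ∀ i, Measurable (ε i)) (hindep : iIndepFun ε P) (hsq : ∀ i, MemLp (ε i) 2 P)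
    (hmean : ∀ i, ∫ ω, ε i ω ∂P = 0) (hvar : ∀ i, ∫ ω, ε i ω ^ 2 ∂P = 1)
    (hb : Summable fun i => b i ^ 2)
    (hup : ∀ i, 0 < P {ω | b i < ε i ω}) (hdown : ∀ i, 0 < P {ω | ε i ω < b i}) {C : ℝ}
    (hC : 1 ≤ C) (hint3 : ∀ i, Integrable (fun ω => |ε i ω| ^ 3) P)
    (hthird : ∀ i, ∫ ω, |ε i ω| ^ 3 ∂P ≤ C) :
    ∃ W : Ω → ℝ, MemLp W 2 P ∧ (∀ᵐ ω ∂P, 0 < W ω) ∧ Integrable (fun ω => (W ω)⁻¹) P ∧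
      ∀ i, ∫ ω, W ω * (ε i ω - b i) ∂P = 0 := by
  have key : ∀ i, ∃ f : ℝ → ℝ, ∃ a : ℝ, Measurable f ∧
      (∃ l u : ℝ, 0 < l ∧ ∀ x, l ≤ f x ∧ f x ≤ u) ∧
      (∫ ω, f (ε i ω) ∂P) = 1 ∧ (∫ ω, f (ε i ω) * ε i ω ∂P) = b i ∧ 0 ≤ a ∧
      (∫ ω, f (ε i ω) ^ 2 ∂P) ≤ 1 + a ∧ (∫ ω, (f (ε i ω))⁻¹ ∂P) ≤ 1 + a ∧
      (16 * C * |b i| ≤ 1 → a ≤ 128 * C ^ 2 * b i ^ 2) := fun i => by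
    by_cases hi : 16 * C * |b i| ≤ 1
    · obtain ⟨f, h1, h2, h3, h4, h5, h6⟩ := exists_density_of_small (hmeas i) (hsq i) (hmean i)
        (hvar i) hC (hint3 i) (hthird i) hi
      exact ⟨f, _, h1, h2, h3, h4, by positivity, h5, h6, fun _ => le_rfl⟩
    · obtain ⟨f, h1, h2, h3, h4⟩ := exists_density_of_split (hmeas i)
        ((hsq i).integrable one_le_two) (hup i) (hdown i)
      -- A crude value is enough here: since `b i → 0`, only finitely many indices fall in this case
      -- and summability is unaffected.
      refine ⟨f, |∫ ω, f (ε i ω) ^ 2 ∂P| + |∫ ω, (f (ε i ω))⁻¹ ∂P|, h1, h2, h3, h4, by positivity,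
        ?_, ?_, fun h => absurd h hi⟩
      · linarith [le_abs_self (∫ ω, f (ε i ω) ^ 2 ∂P), abs_nonneg (∫ ω, (f (ε i ω))⁻¹ ∂P)]
      · linarith [abs_nonneg (∫ ω, f (ε i ω) ^ 2 ∂P), le_abs_self (∫ ω, (f (ε i ω))⁻¹ ∂P)]
  choose f a h1 h2 h3 h4 h5 h6 h7 h8 using key
  refine exists_product_density hmeas hindep hsq h1 h2 h3 h4 h5 ?_ h6 h7
  refine Summable.of_norm_bounded_eventually_nat (hb.mul_left (128 * C ^ 2)) ?_
  have hlim : Tendsto (fun i => (16 * C) ^ 2 * b i ^ 2) atTop (𝓝 0) := by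
    simpa using hb.tendsto_atTop_zero.const_mul ((16 * C) ^ 2)
  filter_upwards [hlim.eventually_le_const zero_lt_one] with i hi
  rw [Real.norm_of_nonneg (h5 i)]
  refine h8 i ?_
  rw [← sq_abs (b i), ← mul_pow] at hi
  exact (sq_le_one_iff₀ (by positivity)).1 hi

/-! ### Third moments of finite portfolios -/

/-- This is the second-order Taylor expansion of `|·|³` at `s` with remainder `|x|³`. The linear
term keeps its sign so that it integrates to zero when `x` is centred and independent of `s`. -/
theorem abs_add_pow_three_le (s x : ℝ) :
    |s + x| ^ 3 ≤ |s| ^ 3 + 3 * (s * |s| * x) + 3 * (|s| * x ^ 2) + |x| ^ 3 := by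
  have aux : ∀ s x : ℝ, 0 ≤ s →
      |s + x| ^ 3 ≤ |s| ^ 3 + 3 * (s * |s| * x) + 3 * (|s| * x ^ 2) + |x| ^ 3 := fun s x hs => by
    rw [abs_of_nonneg hs]
    rcases le_total 0 (s + x) with h | h
    · rw [abs_of_nonneg h]
      have : x ^ 3 ≤ |x| ^ 3 := by rw [← abs_pow]; exact le_abs_self _
      nlinarith
    · have hx : x ≤ 0 := by linarith
      rw [abs_of_nonpos h, abs_of_nonpos hx]
      nlinarith [mul_nonneg hs (by nlinarith [sq_nonneg (2 * s + 3 * x)] :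
        0 ≤ s ^ 2 + 3 * s * x + 3 * x ^ 2)]
  rcases le_total 0 s with hs | hs
  · exact aux s x hs
  · have h := aux (-s) (-x) (by linarith)
    rw [← neg_add, abs_neg, abs_neg, abs_neg] at h
    nlinarith [h]

theorem integral_sq_add_of_indepFun {Ω : Type*} [MeasurableSpace Ω] {P : Measure Ω}
    [IsProbabilityMeasure P] {U Y : Ω → ℝ} (hUY : IndepFun U Y P) (hU : MemLp U 2 P)
    (hY : MemLp Y 2 P) (hY0 : ∫ ω, Y ω ∂P = 0) :
    ∫ ω, (U ω + Y ω) ^ 2 ∂P = ∫ ω, U ω ^ 2 ∂P + ∫ ω, Y ω ^ 2 ∂P := by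
  have hint : Integrable (fun ω => U ω * Y ω) P :=
    hUY.integrable_mul (hU.integrable one_le_two) (hY.integrable one_le_two)
  have h : ∫ ω, U ω * Y ω ∂P = 0 := by
    rw [hUY.integral_fun_mul_eq_mul_integral hU.1 hY.1, hY0, mul_zero]
  have : (fun ω => (U ω + Y ω) ^ 2) = fun ω => (U ω ^ 2 + Y ω ^ 2) + 2 * (U ω * Y ω) := by
    funext ω; ring
  have hsum : Integrable (fun ω => U ω ^ 2 + Y ω ^ 2) P := hU.integrable_sq.add hY.integrable_sq
  rw [this, integral_add hsum (hint.const_mul 2), integral_const_mul, h,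
    integral_add hU.integrable_sq hY.integrable_sq]
  ring

/-- Independence removes the linear Taylor term and factorises the quadratic one. Iterated, this
bounds the third moment of a sum through its variances and third moments, with no factor depending
on the number of terms. -/
theorem integral_abs_cube_add_of_indepFun {Ω : Type*} [MeasurableSpace Ω] {P : Measure Ω}
    [IsProbabilityMeasure P] {U Y : Ω → ℝ} (hUY : IndepFun U Y P) (hU : MemLp U 2 P)
    (hY : MemLp Y 2 P) (hY0 : ∫ ω, Y ω ∂P = 0) (hU3 : Integrable (fun ω => |U ω| ^ 3) P)
    (hY3 : Integrable (fun ω => |Y ω| ^ 3) P) :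
    Integrable (fun ω => |U ω + Y ω| ^ 3) P ∧ ∫ ω, |U ω + Y ω| ^ 3 ∂P ≤
      ∫ ω, |U ω| ^ 3 ∂P + 3 * ((∫ ω, |U ω| ∂P) * ∫ ω, Y ω ^ 2 ∂P) + ∫ ω, |Y ω| ^ 3 ∂P := by
  have hUi := hU.integrable one_le_two
  have hYi := hY.integrable one_le_two
  have hUU : Integrable (fun ω => U ω * |U ω|) P := hU.integrable_mul hU.norm
  have hind1 : IndepFun (fun ω => U ω * |U ω|) Y P :=
    hUY.comp (φ := fun x : ℝ => x * |x|) (ψ := id) (by fun_prop) measurable_id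
  have hind2 : IndepFun (fun ω => |U ω|) (fun ω => Y ω ^ 2) P :=
    hUY.comp (φ := fun x : ℝ => |x|) (ψ := fun x : ℝ => x ^ 2) (by fun_prop) (by fun_prop)
  have i1 : Integrable (fun ω => U ω * |U ω| * Y ω) P := hind1.integrable_mul hUU hYi
  have i2 : Integrable (fun ω => |U ω| * Y ω ^ 2) P :=
    hind2.integrable_mul hUi.abs hY.integrable_sq
  have e1 : ∫ ω, U ω * |U ω| * Y ω ∂P = 0 := by
    rw [hind1.integral_fun_mul_eq_mul_integral hUU.1 hY.1, hY0, mul_zero]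
  have e2 : ∫ ω, |U ω| * Y ω ^ 2 ∂P = (∫ ω, |U ω| ∂P) * ∫ ω, Y ω ^ 2 ∂P :=
    hind2.integral_fun_mul_eq_mul_integral hUi.abs.1 hY.integrable_sq.1
  have j1 : Integrable (fun ω => |U ω| ^ 3 + 3 * (U ω * |U ω| * Y ω)) P :=
    hU3.add (i1.const_mul 3)
  have j2 : Integrable (fun ω => |U ω| ^ 3 + 3 * (U ω * |U ω| * Y ω) + 3 * (|U ω| * Y ω ^ 2)) P :=
    j1.add (i2.const_mul 3)
  have j3 : Integrable (fun ω => |U ω| ^ 3 + 3 * (U ω * |U ω| * Y ω) + 3 * (|U ω| * Y ω ^ 2) +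
    |Y ω| ^ 3) P := j2.add hY3
  refine ⟨j3.mono' ((hU.1.add hY.1).norm.pow 3) (Eventually.of_forall fun ω => ?_), ?_⟩
  · rw [Real.norm_of_nonneg (by positivity)]
    exact abs_add_pow_three_le _ _
  · refine (integral_mono_of_nonneg
      (Eventually.of_forall fun ω => by simp only [Pi.zero_apply]; positivity) j3
      (Eventually.of_forall fun ω => abs_add_pow_three_le _ _)).trans_eq ?_
    rw [integral_add j2 hY3, integral_add j1 (i2.const_mul 3), integral_add hU3 (i1.const_mul 3),
      integral_const_mul, integral_const_mul, e1, e2]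
    ring

/-- Second and third moments of a constant plus a sum of independent centred variables. -/
theorem moments_const_add_sum {Ω : Type*} [MeasurableSpace Ω] {P : Measure Ω}
    [IsProbabilityMeasure P] {Y : ℕ → Ω → ℝ} (hmeas : ∀ i, Measurable (Y i))
    (hindep : iIndepFun Y P) (hsq : ∀ i, MemLp (Y i) 2 P) (hmean : ∀ i, ∫ ω, Y i ω ∂P = 0)
    (hint3 : ∀ i, Integrable (fun ω => |Y i ω| ^ 3) P) (c : ℝ) (n : ℕ) :
    MemLp (fun ω => c + ∑ i ∈ Finset.range n, Y i ω) 2 P ∧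
    ∫ ω, (c + ∑ i ∈ Finset.range n, Y i ω) ^ 2 ∂P =
      c ^ 2 + ∑ i ∈ Finset.range n, ∫ ω, Y i ω ^ 2 ∂P ∧
    Integrable (fun ω => |c + ∑ i ∈ Finset.range n, Y i ω| ^ 3) P ∧
    ∫ ω, |c + ∑ i ∈ Finset.range n, Y i ω| ^ 3 ∂P ≤
      |c| ^ 3 + 3 / 2 * (1 + c ^ 2 + ∑ i ∈ Finset.range n, ∫ ω, Y i ω ^ 2 ∂P) *
        (∑ i ∈ Finset.range n, ∫ ω, Y i ω ^ 2 ∂P) +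
        ∑ i ∈ Finset.range n, ∫ ω, |Y i ω| ^ 3 ∂P := by
  induction n with
  | zero => simp [memLp_const]
  | succ n ih =>
    obtain ⟨h1, h2, h3, h4⟩ := ih
    have hind : IndepFun (fun ω => c + ∑ i ∈ Finset.range n, Y i ω) (Y n) P := by
      have := (hindep.indepFun_sum_range_succ hmeas n).comp (φ := fun x : ℝ => c + x) (ψ := id)
        (by fun_prop) measurable_id
      simpa [Function.comp_def] using this
    have hD : ∫ ω, |c + ∑ i ∈ Finset.range n, Y i ω| ∂P ≤
        (1 + c ^ 2 + ∑ i ∈ Finset.range n, ∫ ω, Y i ω ^ 2 ∂P) / 2 := by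
      have h := integral_mono (h1.integrable one_le_two).abs
        (((integrable_const 1).add h1.integrable_sq).div_const 2) fun ω => by
          simp only [Pi.add_apply]
          nlinarith [sq_nonneg (|c + ∑ i ∈ Finset.range n, Y i ω| - 1),
            sq_abs (c + ∑ i ∈ Finset.range n, Y i ω)]
      simp only [Pi.add_apply] at h
      rw [integral_div, integral_add (integrable_const 1) h1.integrable_sq, h2] at h
      simpa [add_assoc] using h
    obtain ⟨h5, h6⟩ := integral_abs_cube_add_of_indepFun hind h1 (hsq n) (hmean n) h3 (hint3 n)
    have h7 := integral_sq_add_of_indepFun hind h1 (hsq n) (hmean n)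
    have hv : 0 ≤ ∫ ω, Y n ω ^ 2 ∂P := integral_nonneg fun ω => sq_nonneg _
    have hV : 0 ≤ ∑ i ∈ Finset.range n, ∫ ω, Y i ω ^ 2 ∂P :=
      Finset.sum_nonneg fun i _ => integral_nonneg fun ω => sq_nonneg _
    simp only [Finset.sum_range_succ, ← add_assoc] at h5 h6 h7 ⊢
    refine ⟨h1.add (hsq n), by rw [h7, h2], h5, h6.trans ?_⟩
    generalize (∑ i ∈ Finset.range n, ∫ ω, Y i ω ^ 2 ∂P) = V at *
    generalize (∫ ω, Y n ω ^ 2 ∂P) = v at *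
    have := mul_le_mul_of_nonneg_right hD hv
    nlinarith [sq_nonneg v, mul_nonneg hv hV, mul_nonneg hv (sq_nonneg c)]

/-! ### Uniform lower bound for losses -/

/-- Each regime is absorbed by one term: `|x| ≤ 1/2` by the constant, `|x| ≥ M` by the cube. In
between `x² ≤ M²`, and either `w ≥ η`, so `w|x| ≥ η/2`, or `w ≤ η`, so `η / w ≥ 1`. Integrated with
`w = W`, it bounds `E[W|X|]` from below. -/
theorem sq_le_of_density {x w M η : ℝ} (hM : 0 < M) (hw : 0 < w) (hη : 0 < η) :
    x ^ 2 ≤ 1 / 4 + |x| ^ 3 / M + (2 * M ^ 2 / η * (w * |x|) + M ^ 2 * η * w⁻¹) := by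
  have h0 : 0 ≤ |x| := abs_nonneg x
  have t1 : 0 ≤ |x| ^ 3 / M := by positivity
  have t2 : 0 ≤ 2 * M ^ 2 / η * (w * |x|) := by positivity
  have t3 : 0 ≤ M ^ 2 * η * w⁻¹ := by positivity
  rw [← sq_abs]
  rcases le_total |x| (1 / 2) with h | h
  · nlinarith
  rcases le_total M |x| with h' | h'
  · have : |x| ^ 2 ≤ |x| ^ 3 / M := by
      rw [le_div_iff₀ hM]
      nlinarith [sq_nonneg |x|]
    linarith
  have hx : |x| ^ 2 ≤ M ^ 2 := pow_le_pow_left₀ h0 h' 2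
  rcases le_total η w with hw' | hw'
  · have : M ^ 2 ≤ 2 * M ^ 2 / η * (w * |x|) := by
      rw [div_mul_eq_mul_div, le_div_iff₀ hη, mul_comm 2 (M ^ 2), mul_assoc]
      have : η ≤ 2 * (w * |x|) := by nlinarith
      exact mul_le_mul_of_nonneg_left this (sq_nonneg M)
    linarith
  · have : M ^ 2 ≤ M ^ 2 * η * w⁻¹ := by
      rw [mul_assoc]
      refine le_mul_of_one_le_right (sq_nonneg M) ?_
      rw [← div_eq_mul_inv]
      exact (one_le_div hw).2 hw'
    linarith

/-- A normalised finite portfolio with zero price loses, on average under the pricing density, at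
least a fixed amount. -/
theorem exists_loss_bound {Ω : Type*} [MeasurableSpace Ω] {P : Measure Ω}
    [IsProbabilityMeasure P] {ε : ℕ → Ω → ℝ} {b : ℕ → ℝ}
    (hmeas : ∀ i, Measurable (ε i)) (hindep : iIndepFun ε P) (hsq : ∀ i, MemLp (ε i) 2 P)
    (hmean : ∀ i, ∫ ω, ε i ω ∂P = 0) (hvar : ∀ i, ∫ ω, ε i ω ^ 2 ∂P = 1)
    (hb : Summable fun i => b i ^ 2) {C : ℝ}
    (hint3 : ∀ i, Integrable (fun ω => |ε i ω| ^ 3) P)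
    (hthird : ∀ i, ∫ ω, |ε i ω| ^ 3 ∂P ≤ C) {W : Ω → ℝ} (hW : MemLp W 2 P)
    (hWpos : ∀ᵐ ω ∂P, 0 < W ω) (hWinv : Integrable (fun ω => (W ω)⁻¹) P)
    (hWε : ∀ i, ∫ ω, W ω * (ε i ω - b i) ∂P = 0) :
    ∃ c > 0, ∀ (n : ℕ) (h : ℕ → ℝ), ∑ i ∈ Finset.range n, h i ^ 2 = 1 →
      c ≤ ∫ ω, W ω * max (-(∑ i ∈ Finset.range n, h i * (ε i ω - b i))) 0 ∂P := by
  have hC0 : 0 ≤ C := (integral_nonneg fun ω => by positivity).trans (hthird 0)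
  set β := ∑' i, b i ^ 2 with hβ
  have hβ0 : 0 ≤ β := tsum_nonneg fun i => sq_nonneg _
  set κ := ∫ ω, (W ω)⁻¹ ∂P with hκ
  have hκ0 : 0 ≤ κ := integral_nonneg_of_ae (hWpos.mono fun ω h => (inv_pos.2 h).le)
  -- `K` bounds the third moment of every normalised portfolio. `M` and `η` make the cubic and
  -- inverse terms of `sq_le_of_density` at most `1/4` each; with the constant `1/4` and `E X² ≥ 1`,
  -- at least `1/4` is left for the term in `W * |X|`.
  set K := (1 + β) * β + 3 / 2 * (2 + β) + C with hK
  have hK0 : 0 < K := by positivity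
  set M := 4 * K with hM
  have hM0 : 0 < M := by positivity
  set η := 1 / (4 * M ^ 2 * (κ + 1)) with hη
  have hη0 : 0 < η := by positivity
  refine ⟨η / (16 * M ^ 2), by positivity, fun n h hh => ?_⟩
  set c := -∑ i ∈ Finset.range n, h i * b i with hc
  set X : Ω → ℝ := fun ω => ∑ i ∈ Finset.range n, h i * (ε i ω - b i) with hX
  have hXc : ∀ ω, X ω = c + ∑ i ∈ Finset.range n, h i * ε i ω := fun ω => by
    simp only [hX, hc, mul_sub, Finset.sum_sub_distrib]; ring
  have hY3 : ∀ i, (fun ω => |h i * ε i ω| ^ 3) = fun ω => |h i| ^ 3 * |ε i ω| ^ 3 := fun i => by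
    funext ω; rw [abs_mul, mul_pow]
  obtain ⟨m1, m2, m3, m4⟩ := moments_const_add_sum (P := P) (Y := fun i ω => h i * ε i ω)
    (fun i => (hmeas i).const_mul _)
    (hindep.comp (fun i x => h i * x) fun i => measurable_const_mul _)
    (fun i => (hsq i).const_mul _)
    (fun i => by rw [integral_const_mul, hmean, mul_zero])
    (fun i => by rw [hY3]; exact (hint3 i).const_mul _) c n
  have hv : ∑ i ∈ Finset.range n, ∫ ω, (h i * ε i ω) ^ 2 ∂P = 1 := by
    simp_rw [mul_pow, integral_const_mul, hvar, mul_one]; exact hh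
  have hle1 : ∀ i ∈ Finset.range n, |h i| ≤ 1 := fun i hi => by
    rw [← sq_le_one_iff_abs_le_one, ← hh]
    exact Finset.single_le_sum (f := fun i => h i ^ 2) (fun j _ => sq_nonneg _) hi
  have ht : ∑ i ∈ Finset.range n, ∫ ω, |h i * ε i ω| ^ 3 ∂P ≤ C := by
    calc _ ≤ ∑ i ∈ Finset.range n, h i ^ 2 * C := Finset.sum_le_sum fun i hi => by
          rw [hY3, integral_const_mul]
          have h1 : |h i| ^ 3 ≤ h i ^ 2 := by
            rw [← sq_abs (h i)]
            exact pow_le_pow_of_le_one (abs_nonneg _) (hle1 i hi) (by norm_num)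
          exact mul_le_mul h1 (hthird i) (integral_nonneg fun ω => by positivity) (sq_nonneg _)
      _ = C := by rw [← Finset.sum_mul, hh, one_mul]
  have hc2 : c ^ 2 ≤ β := by
    rw [hc, neg_sq]
    calc _ ≤ (∑ i ∈ Finset.range n, h i ^ 2) * ∑ i ∈ Finset.range n, b i ^ 2 :=
          Finset.sum_mul_sq_le_sq_mul_sq _ _ _
      _ ≤ β := by
          rw [hh, one_mul]
          exact hb.sum_le_tsum _ fun i _ => sq_nonneg _
  have hc3 : |c| ^ 3 ≤ (1 + β) * β := by
    have h1 : |c| ≤ 1 + c ^ 2 := by nlinarith [sq_nonneg (|c| - 1), sq_abs c]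
    calc |c| ^ 3 = |c| * c ^ 2 := by rw [← sq_abs c]; ring
      _ ≤ (1 + β) * β := mul_le_mul (h1.trans (by linarith)) hc2 (sq_nonneg _) (by positivity)
  simp_rw [← hXc] at m1 m2 m3 m4
  rw [hv] at m2 m4
  have hX3 : ∫ ω, |X ω| ^ 3 ∂P ≤ K := by
    rw [hK]; linarith
  have hWX : Integrable (fun ω => W ω * X ω) P := hW.integrable_mul m1
  have hWabs : Integrable (fun ω => W ω * |X ω|) P := hW.integrable_mul m1.norm
  have hzero : ∫ ω, W ω * X ω ∂P = 0 := by
    have hsum : ∀ ω, W ω * X ω = ∑ i ∈ Finset.range n, h i * (W ω * (ε i ω - b i)) := fun ω => by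
      simp only [hX, Finset.mul_sum]
      exact Finset.sum_congr rfl fun i _ => by ring
    simp_rw [hsum]
    rw [integral_finsetSum]
    · exact Finset.sum_eq_zero fun i _ => by rw [integral_const_mul, hWε, mul_zero]
    · intro i _
      have hi : Integrable (fun ω => W ω * (ε i ω - b i)) P :=
        hW.integrable_mul ((hsq i).sub (memLp_const (b i)))
      exact hi.const_mul _
  have hmaxi : Integrable (fun ω => W ω * max (-X ω) 0) P := by
    refine ((hWabs.sub hWX).div_const 2).congr (Eventually.of_forall fun ω => ?_)
    simp only [Pi.sub_apply]
    rcases le_total 0 (X ω) with h | h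
    · rw [abs_of_nonneg h, max_eq_right (by linarith)]; ring
    · rw [abs_of_nonpos h, max_eq_left (by linarith)]; ring
  -- Zero price under `W` means that positive and negative parts have equal weight.
  have habs : ∫ ω, W ω * |X ω| ∂P = 2 * ∫ ω, W ω * max (-X ω) 0 ∂P := by
    have : (fun ω => W ω * |X ω|) = fun ω => W ω * X ω + 2 * (W ω * max (-X ω) 0) := by
      funext ω
      rcases le_total 0 (X ω) with h | h
      · rw [abs_of_nonneg h, max_eq_right (by linarith)]; ring
      · rw [abs_of_nonpos h, max_eq_left (by linarith)]; ring
    rw [this, integral_add hWX (hmaxi.const_mul 2), hzero, zero_add, integral_const_mul]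
  have j1 : Integrable (fun ω => 1 / 4 + |X ω| ^ 3 / M) P :=
    (integrable_const _).add (m3.div_const M)
  have j2 : Integrable (fun ω => 2 * M ^ 2 / η * (W ω * |X ω|) + M ^ 2 * η * (W ω)⁻¹) P :=
    (hWabs.const_mul _).add (hWinv.const_mul _)
  have hmain : ∫ ω, X ω ^ 2 ∂P ≤ 1 / 4 + (∫ ω, |X ω| ^ 3 ∂P) / M +
      (2 * M ^ 2 / η * (2 * ∫ ω, W ω * max (-X ω) 0 ∂P) + M ^ 2 * η * κ) := by
    refine (integral_mono_ae m1.integrable_sq (j1.add j2)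
      (hWpos.mono fun ω hω => sq_le_of_density hM0 hω hη0)).trans_eq ?_
    simp only [Pi.add_apply]
    rw [integral_add j1 j2, integral_add (integrable_const _) (m3.div_const M),
      integral_add (hWabs.const_mul _) (hWinv.const_mul _), integral_const_mul,
      integral_const_mul, habs, ← hκ]
    simp [integral_div]
  rw [m2] at hmain
  have hq1 : (∫ ω, |X ω| ^ 3 ∂P) / M ≤ 1 / 4 := by
    rw [div_le_iff₀ hM0, hM]; linarith
  have hq2 : M ^ 2 * η * κ ≤ 1 / 4 := by
    rw [hη, mul_one_div, div_mul_eq_mul_div, div_le_iff₀ (by positivity)]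
    nlinarith [sq_nonneg M]
  have hq3 : 1 / 4 ≤ 2 * M ^ 2 / η * (2 * ∫ ω, W ω * max (-X ω) 0 ∂P) := by
    nlinarith [sq_nonneg c]
  change η / (16 * M ^ 2) ≤ ∫ ω, W ω * max (-X ω) 0 ∂P
  rw [div_mul_eq_mul_div, le_div_iff₀ hη0] at hq3
  rw [div_le_iff₀ (by positivity)]
  linarith

/-! ### Closedness of the dominated cone -/

/-- A decreasing sequence of nonempty bounded closed convex sets in a Hilbert space has a common
point. -/
theorem nonempty_iInter_of_convex {H : Type*} [NormedAddCommGroup H] [InnerProductSpace ℝ H]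
    [CompleteSpace H] {S : ℕ → Set H} (hS : Antitone S) (hne : ∀ n, (S n).Nonempty)
    (hcl : ∀ n, IsClosed (S n)) (hconv : ∀ n, Convex ℝ (S n)) {R : ℝ}
    (hR : ∀ h ∈ S 0, ‖h‖ ≤ R) : (⋂ n, S n).Nonempty := by
  have hmin : ∀ n, ∃ v ∈ S n, ∀ w ∈ S n, ‖v‖ ≤ ‖w‖ := fun n => by
    obtain ⟨v, hv, hvn⟩ := exists_norm_eq_iInf_of_complete_convex (hne n)
      (hcl n).isComplete (hconv n) 0
    refine ⟨v, hv, fun w hw => ?_⟩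
    simp only [zero_sub, norm_neg] at hvn
    rw [hvn]
    exact ciInf_le ⟨0, by rintro _ ⟨x, rfl⟩; exact norm_nonneg _⟩ (⟨w, hw⟩ : S n)
  choose v hv hvmin using hmin
  have hmono : Monotone fun n => ‖v n‖ ^ 2 := fun n m hnm =>
    pow_le_pow_left₀ (norm_nonneg _) (hvmin n _ (hS hnm (hv m))) 2
  have hbdd : BddAbove (Set.range fun n => ‖v n‖ ^ 2) := ⟨R ^ 2, by
    rintro _ ⟨n, rfl⟩
    exact pow_le_pow_left₀ (norm_nonneg _) (hR _ (hS (Nat.zero_le n) (hv n))) 2⟩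
  -- The midpoint of `v m` and `v n` lies in `S n`, so its norm is at least `‖v n‖`; the
  -- parallelogram law then makes the least-norm points Cauchy, without any weak compactness.
  have hdist : ∀ {n m : ℕ}, n ≤ m → ‖v m - v n‖ ^ 2 ≤ 2 * (‖v m‖ ^ 2 - ‖v n‖ ^ 2) :=
    fun {n m} hnm => by
      have hmid : (1 / 2 : ℝ) • v m + (1 / 2 : ℝ) • v n ∈ S n :=
        hconv n (hS hnm (hv m)) (hv n) (by norm_num) (by norm_num) (by norm_num)
      have h1 := hvmin n _ hmid
      rw [← smul_add, norm_smul, Real.norm_of_nonneg (by norm_num)] at h1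
      have h2 := parallelogram_law_with_norm ℝ (v m) (v n)
      nlinarith [norm_nonneg (v n), norm_nonneg (v m + v n)]
  have hcau : CauchySeq v := by
    rw [Metric.cauchySeq_iff']
    intro δ hδ
    obtain ⟨N, hN⟩ := Metric.cauchySeq_iff'.1
      (tendsto_atTop_ciSup hmono hbdd).cauchySeq (δ ^ 2 / 2) (by positivity)
    refine ⟨N, fun n hn => ?_⟩
    have h := hN n hn
    rw [Real.dist_eq] at h
    rw [dist_eq_norm]
    refine lt_of_pow_lt_pow_left₀ 2 hδ.le ?_
    linarith [hdist hn, le_abs_self (‖v n‖ ^ 2 - ‖v N‖ ^ 2)]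
  obtain ⟨x, hx⟩ := cauchySeq_tendsto_of_complete hcau
  refine ⟨x, Set.mem_iInter.2 fun n => (hcl n).mem_of_tendsto hx ?_⟩
  filter_upwards [eventually_ge_atTop n] with m hm
  exact hS hm (hv m)

/-- If `T h` cannot be almost positive unless `h` is small, the cone of elements dominated by the
range of `T` is closed. -/
theorem isClosed_dominated {H E : Type*} [NormedAddCommGroup H] [InnerProductSpace ℝ H]
    [CompleteSpace H] [NormedAddCommGroup E] [Lattice E] [HasSolidNorm E] [IsOrderedAddMonoid E]
    [NormedSpace ℝ E] [PosSMulMono ℝ E] (T : H →L[ℝ] E) {c : ℝ} (hc : 0 < c)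
    (hT : ∀ h, c * ‖h‖ ≤ ‖(T h)⁻‖) : IsClosed {y | ∃ h, y ≤ T h} := by
  refine isClosed_of_closure_subset fun y hy => ?_
  have hposle : ∀ {u v : E}, u ≤ v → ‖u⁺‖ ≤ ‖v‖ := fun {u v} huv => by
    refine norm_le_norm_of_abs_le_abs ?_
    rw [abs_of_nonneg (posPart_nonneg u)]
    exact (posPart_mono huv).trans (sup_le (le_abs_self v) (abs_nonneg v))
  -- Strategies with shortfall at most `1 / (n + 1)`: a common point has none. On `S 0` the loss `(T
  -- h)⁻` is at most the shortfall plus `|y|`, so coercivity bounds `h`.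
  set S : ℕ → Set H := fun n => {h | ‖(y - T h)⁺‖ ≤ 1 / ((n : ℝ) + 1)} with hS
  have hne : ∀ n, (S n).Nonempty := fun n => by
    obtain ⟨y', ⟨h, hh⟩, hd⟩ := Metric.mem_closure_iff.1 hy (1 / ((n : ℝ) + 1)) (by positivity)
    refine ⟨h, (hposle (sub_le_sub_left hh y)).trans ?_⟩
    rw [← dist_eq_norm]
    exact hd.le
  have hcl : ∀ n, IsClosed (S n) := fun n =>
    isClosed_le (continuous_posPart.comp (continuous_const.sub T.continuous)).norm
      continuous_const
  have hconv : ∀ n, Convex ℝ (S n) := fun n u hu v hv s t hs ht hst => by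
    have h1 : y - T (s • u + t • v) = s • (y - T u) + t • (y - T v) := by
      rw [map_add, map_smul, map_smul, smul_sub, smul_sub]
      nth_rewrite 1 [← one_smul ℝ y]
      rw [← hst, add_smul]
      abel
    have h2 : y - T (s • u + t • v) ≤ s • (y - T u)⁺ + t • (y - T v)⁺ := by
      rw [h1]
      exact add_le_add (smul_le_smul_of_nonneg_left (le_posPart _) hs)
        (smul_le_smul_of_nonneg_left (le_posPart _) ht)
    refine (hposle h2).trans ((norm_add_le _ _).trans ?_)
    rw [norm_smul, norm_smul, Real.norm_of_nonneg hs, Real.norm_of_nonneg ht]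
    calc s * ‖(y - T u)⁺‖ + t * ‖(y - T v)⁺‖
        ≤ s * (1 / ((n : ℝ) + 1)) + t * (1 / ((n : ℝ) + 1)) :=
          add_le_add (mul_le_mul_of_nonneg_left hu hs) (mul_le_mul_of_nonneg_left hv ht)
      _ = _ := by rw [← add_mul, hst, one_mul]
  have hanti : Antitone S := fun n m hnm h (hh : ‖(y - T h)⁺‖ ≤ 1 / ((m : ℝ) + 1)) =>
    hh.trans (Nat.one_div_le_one_div hnm)
  have hbdd : ∀ h ∈ S 0, ‖h‖ ≤ (1 + ‖y‖) / c := fun h hh => by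
    rw [le_div_iff₀ hc, mul_comm]
    refine (hT h).trans ?_
    have h1 : (T h)⁻ ≤ (y - T h)⁺ + |y| := by
      refine sup_le ?_ (add_nonneg (posPart_nonneg _) (abs_nonneg _))
      calc -T h = (y - T h) + -y := by abel
        _ ≤ _ := add_le_add (le_posPart _) (neg_le_abs y)
    have h2 : ‖(T h)⁻‖ ≤ ‖(y - T h)⁺ + |y|‖ := by
      refine norm_le_norm_of_abs_le_abs ?_
      rw [abs_of_nonneg (negPart_nonneg _)]
      exact h1.trans (le_abs_self _)
    have h3 : ‖(y - T h)⁺‖ ≤ 1 := by simpa [hS] using hh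
    calc _ ≤ ‖(y - T h)⁺‖ + ‖|y|‖ := h2.trans (norm_add_le _ _)
      _ ≤ _ := by rw [norm_abs_eq_norm]; linarith
  obtain ⟨h, hh⟩ := nonempty_iInter_of_convex hanti hne hcl hconv hbdd
  refine ⟨h, ?_⟩
  have h0 : ‖(y - T h)⁺‖ ≤ 0 := ge_of_tendsto' tendsto_one_div_add_atTop_nhds_zero_nat
    fun n => Set.mem_iInter.1 hh n
  rw [norm_le_zero_iff, posPart_eq_zero] at h0
  exact sub_nonpos.1 h0

/-! ### Order, orthogonality and separation in `L²` -/

instance posSMulMono_Lp {Ω : Type*} [MeasurableSpace Ω] {P : Measure Ω} :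
    PosSMulMono ℝ (Lp ℝ 2 P) where
  smul_le_smul_of_nonneg_left a ha u v huv := by
    rw [← Lp.coeFn_le] at huv ⊢
    filter_upwards [huv, Lp.coeFn_smul a u, Lp.coeFn_smul a v] with ω h h1 h2
    rw [h1, h2]
    exact smul_le_smul_of_nonneg_left h ha

theorem coeFn_negPart_Lp {Ω : Type*} [MeasurableSpace Ω] {P : Measure Ω} (F : Lp ℝ 2 P) :
    ⇑F⁻ =ᵐ[P] fun ω => max (-F ω) 0 := by
  rw [negPart_def]
  filter_upwards [Lp.coeFn_sup (-F) 0, Lp.coeFn_neg F, Lp.coeFn_zero ℝ 2 P] with ω h1 h2 h3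
  rw [h1, Pi.sup_apply, h2, h3]
  rfl

/-- In `L²`, an element pairing non-negatively with every non-negative element is
non-negative. -/
theorem nonneg_of_inner_nonneg {Ω : Type*} [MeasurableSpace Ω] {P : Measure Ω} {F : Lp ℝ 2 P}
    (hF : ∀ v : Lp ℝ 2 P, 0 ≤ v → 0 ≤ inner ℝ F v) : 0 ≤ F := by
  -- Testing against the negative part itself gives `-‖F⁻‖ ^ 2 ≥ 0`.
  have h := hF F⁻ (negPart_nonneg F)
  have h1 : inner ℝ F F⁻ = -‖F⁻‖ ^ 2 := by
    rw [inner_Lp, sq_norm_Lp, ← integral_neg]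
    refine integral_congr_ae ?_
    filter_upwards [coeFn_negPart_Lp F] with ω hω
    rw [hω]
    rcases le_total 0 (F ω) with h | h
    · rw [max_eq_right (by linarith)]; ring
    · rw [max_eq_left (by linarith)]; ring
  rw [← negPart_eq_zero, ← norm_eq_zero]
  nlinarith [norm_nonneg F⁻]

theorem inner_nonneg_of_nonneg {Ω : Type*} [MeasurableSpace Ω] {P : Measure Ω}
    {F G : Lp ℝ 2 P} (hF : 0 ≤ F) (hG : 0 ≤ G) : 0 ≤ inner ℝ F G := by
  rw [inner_Lp]
  refine integral_nonneg_of_ae ?_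
  filter_upwards [(Lp.coeFn_nonneg F).2 hF, (Lp.coeFn_nonneg G).2 hG] with ω h1 h2
  exact mul_nonneg h1 h2

theorem orthonormal_toLp {Ω : Type*} [MeasurableSpace Ω] {P : Measure Ω} {ε : ℕ → Ω → ℝ}
    (hindep : iIndepFun ε P) (hsq : ∀ i, MemLp (ε i) 2 P)
    (hmean : ∀ i, ∫ ω, ε i ω ∂P = 0) (hvar : ∀ i, ∫ ω, ε i ω ^ 2 ∂P = 1) :
    Orthonormal ℝ fun i => (hsq i).toLp (ε i) := by
  rw [orthonormal_iff_ite]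
  intro i j
  rw [inner_toLp]
  split_ifs with h
  · subst h
    simp_rw [← sq, hvar]
  · rw [(hindep.indepFun h).integral_fun_mul_eq_mul_integral (hsq i).1 (hsq j).1, hmean, zero_mul]

/-- An element outside the closed cone of dominated gains is separated from it by a positive
functional that vanishes on the gains. -/
theorem exists_separating_density {Ω : Type*} [MeasurableSpace Ω] {P : Measure Ω}
    {T : ℓ²(ℕ, ℝ) →L[ℝ] Lp ℝ 2 P}
    (hcl : IsClosed {y | ∃ h, y ≤ T h}) {y : Lp ℝ 2 P} (hy : ¬∃ h, y ≤ T h) :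
    ∃ Z : Lp ℝ 2 P, 0 ≤ Z ∧ (∀ h, inner ℝ Z (T h) = 0) ∧ 0 < inner ℝ Z y := by
  let K : ProperCone ℝ (Lp ℝ 2 P) :=
    { carrier := {y | ∃ h, y ≤ T h}
      add_mem' := by
        rintro u v ⟨h, hu⟩ ⟨k, hv⟩
        exact ⟨h + k, by rw [map_add]; exact add_le_add hu hv⟩
      zero_mem' := ⟨0, by rw [map_zero]⟩
      smul_mem' := by
        rintro s u ⟨h, hu⟩
        refine ⟨(s : ℝ) • h, ?_⟩
        rw [map_smul]
        exact smul_le_smul_of_nonneg_left (a := (s : ℝ)) hu s.2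
      isClosed' := hcl }
  have hK : ∀ u, u ∈ K ↔ ∃ h, u ≤ T h := fun u => Iff.rfl
  obtain ⟨F, hF, hFy⟩ := K.hyperplane_separation' (mt (hK y).1 hy)
  have hT : ∀ h, 0 ≤ inner ℝ F (T h) := fun h => by
    rw [real_inner_comm]
    exact hF _ ((hK _).2 ⟨h, le_rfl⟩)
  -- The cone contains every non-positive element, which forces `-F ≥ 0`, and both `T h` and `T
  -- (-h)`, which forces orthogonality.
  refine ⟨-F, nonneg_of_inner_nonneg fun v hv => ?_, fun h => ?_, ?_⟩
  · have h1 := hF (-v) ((hK _).2 ⟨0, by rw [map_zero]; exact neg_nonpos.2 hv⟩)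
    rwa [inner_neg_left, ← inner_neg_right, real_inner_comm]
  · have h1 := hT h
    have h2 := hT (-h)
    rw [map_neg, inner_neg_right] at h2
    rw [inner_neg_left]
    linarith
  · rw [inner_neg_left, real_inner_comm]
    linarith

/-! ### The gain operator and superreplication -/

section Market

variable {Ω : Type*} [MeasurableSpace Ω] {P : Measure Ω} [IsProbabilityMeasure P]
  {ε : ℕ → Ω → ℝ} {b : ℕ → ℝ}

/-- The unit payoff. -/
noncomputable def bond (P : Measure Ω) [IsProbabilityMeasure P] : Lp ℝ 2 P :=
  (memLp_const (1 : ℝ)).toLp fun _ => 1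

/-- The excess return `ε i - b i` of the `i`-th asset. -/
noncomputable def excess (hsq : ∀ i, MemLp (ε i) 2 P) (b : ℕ → ℝ) (i : ℕ) : Lp ℝ 2 P :=
  ((hsq i).sub (memLp_const (b i))).toLp fun ω => ε i ω - b i

/-- The gain operator, sending a strategy `h ∈ ℓ₂` to `∑ i, h i * (ε i - b i)`. -/
theorem exists_gain_operator (hindep : iIndepFun ε P) (hsq : ∀ i, MemLp (ε i) 2 P)
    (hmean : ∀ i, ∫ ω, ε i ω ∂P = 0) (hvar : ∀ i, ∫ ω, ε i ω ^ 2 ∂P = 1) (hb : Memℓp b 2) :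
    ∃ T : ℓ²(ℕ, ℝ) →L[ℝ] Lp ℝ 2 P, ∀ h : ℓ²(ℕ, ℝ),
      HasSum (fun i => h i • excess hsq b i) (T h) := by
  have hV := (orthonormal_toLp hindep hsq hmean hvar).orthogonalFamily
  let B : ℓ²(ℕ, ℝ) := ⟨b, hb⟩
  -- The part in `ε` is an isometry because the `ε i` are orthonormal; the part in `b` is the
  -- rank-one map `h ↦ ⟨b, h⟩ • 1`, bounded because `b ∈ ℓ₂`.
  refine ⟨hV.linearIsometry.toContinuousLinearMap - (innerSL ℝ B).smulRight (bond P), fun h => ?_⟩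
  have h1 : HasSum (fun i => h i • (hsq i).toLp (ε i)) (hV.linearIsometry h) := by
    simpa using hV.hasSum_linearIsometry h
  have h2 : HasSum (fun i => (h i * b i) • bond P) ((inner ℝ B h) • bond P) := by
    have h3 := lp.hasSum_inner (𝕜 := ℝ) (G := fun _ : ℕ => ℝ) B h
    exact h3.smul_const _
  refine (h1.sub h2).congr_fun fun i => ?_
  have h4 : excess hsq b i = (hsq i).toLp (ε i) - b i • bond P := by
    rw [excess, bond, ← MemLp.toLp_const_smul, ← MemLp.toLp_sub]
    exact MemLp.toLp_congr _ _ (Eventually.of_forall fun ω => by simp)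
  rw [h4, smul_sub, mul_smul]

theorem memLp_portfolio (hsq : ∀ i, MemLp (ε i) 2 P) (b h : ℕ → ℝ) (x : ℝ) (n : ℕ) :
    MemLp (fun ω => x + ∑ i ∈ Finset.range n, h i * (ε i ω - b i)) 2 P :=
  (memLp_const x).add (memLp_finsetSum _ fun i _ =>
    ((hsq i).sub (memLp_const (b i))).const_mul (h i))

theorem toLp_portfolio (hsq : ∀ i, MemLp (ε i) 2 P) (b h : ℕ → ℝ) (x : ℝ) (n : ℕ) :
    (memLp_portfolio hsq b h x n).toLp _ =
      x • bond P + ∑ i ∈ Finset.range n, h i • excess hsq b i := by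
  induction n with
  | zero =>
    simp only [Finset.range_zero, Finset.sum_empty, add_zero]
    rw [bond, ← MemLp.toLp_const_smul]
    refine MemLp.toLp_congr _ _ (Eventually.of_forall fun ω => ?_)
    simp
  | succ n ih =>
    rw [Finset.sum_range_succ, ← add_assoc, ← ih, excess, ← MemLp.toLp_const_smul,
      ← MemLp.toLp_add]
    refine MemLp.toLp_congr _ _ (Eventually.of_forall fun ω => ?_)
    simp [Finset.sum_range_succ, add_assoc]

theorem isTerminalValue_iff (hsq : ∀ i, MemLp (ε i) 2 P) {T : ℓ²(ℕ, ℝ) →L[ℝ] Lp ℝ 2 P}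
    (hT : ∀ h : ℓ²(ℕ, ℝ), HasSum (fun i => h i • excess hsq b i) (T h)) (x : ℝ) (h : ℓ²(ℕ, ℝ))
    (V : Ω → ℝ) :
    IsTerminalValue P ε b x h V ↔ ∃ hV : MemLp V 2 P, hV.toLp V = x • bond P + T h := by
  have hlim : Tendsto (fun n => (memLp_portfolio hsq b h x n).toLp _) atTop
      (𝓝 (x • bond P + T h)) :=
    ((hT h).tendsto_sum_nat.const_add (x • bond P)).congr fun n =>
      (toLp_portfolio hsq b h x n).symm
  have key : ∀ hV : MemLp V 2 P,
      Tendsto (fun n => (memLp_portfolio hsq b h x n).toLp _) atTop (𝓝 (hV.toLp V)) ↔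
      Tendsto (fun n : ℕ => eLpNorm
        (fun ω => (x + ∑ i ∈ Finset.range n, h i * (ε i ω - b i)) - V ω) 2 P) atTop (𝓝 0) :=
    fun hV => Lp.tendsto_Lp_iff_tendsto_eLpNorm'' _ (memLp_portfolio hsq b h x) V hV
  constructor
  · rintro ⟨hV, hlimV⟩
    exact ⟨hV, tendsto_nhds_unique ((key hV).2 hlimV) hlim⟩
  · rintro ⟨hV, hVeq⟩
    exact ⟨hV, (key hV).1 (hVeq ▸ hlim)⟩

theorem superreplicating_nonempty_iff (hsq : ∀ i, MemLp (ε i) 2 P)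
    {T : ℓ²(ℕ, ℝ) →L[ℝ] Lp ℝ 2 P}
    (hT : ∀ h : ℓ²(ℕ, ℝ), HasSum (fun i => h i • excess hsq b i) (T h)) {G : Ω → ℝ}
    (hG : MemLp G 2 P) (x : ℝ) :
    (superreplicating P ε b G x).Nonempty ↔ ∃ h, hG.toLp G - x • bond P ≤ T h := by
  constructor
  · rintro ⟨h, V, hV, hGV⟩
    obtain ⟨hV2, hVeq⟩ := (isTerminalValue_iff hsq hT x h V).1 hV
    refine ⟨h, ?_⟩
    rw [sub_le_iff_le_add', ← hVeq, ← Lp.coeFn_le]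
    filter_upwards [hG.coeFn_toLp, hV2.coeFn_toLp, hGV] with ω h1 h2 h3
    rwa [h1, h2]
  · rintro ⟨h, hh⟩
    refine ⟨h, ⇑(x • bond P + T h),
      (isTerminalValue_iff hsq hT x h _).2 ⟨Lp.memLp _, Lp.toLp_coeFn _ _⟩, ?_⟩
    rw [sub_le_iff_le_add', ← Lp.coeFn_le] at hh
    filter_upwards [hG.coeFn_toLp, hh] with ω h1 h2
    rwa [h1] at h2

/-- By homogeneity and Cauchy–Schwarz against `W`, the loss bound for normalised finite portfolios
becomes a norm bound for all finite ones; continuity of the negative part carries it to the limit.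
-/
theorem gain_coercive (hsq : ∀ i, MemLp (ε i) 2 P) {T : ℓ²(ℕ, ℝ) →L[ℝ] Lp ℝ 2 P}
    (hT : ∀ h : ℓ²(ℕ, ℝ), HasSum (fun i => h i • excess hsq b i) (T h)) {W : Lp ℝ 2 P} {c : ℝ}
    (hc : ∀ (n : ℕ) (h : ℕ → ℝ), ∑ i ∈ Finset.range n, h i ^ 2 = 1 →
      c ≤ ∫ ω, W ω * max (-(∑ i ∈ Finset.range n, h i * (ε i ω - b i))) 0 ∂P)
    (h : ℓ²(ℕ, ℝ)) : c * ‖h‖ ≤ ‖W‖ * ‖(T h)⁻‖ := by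
  have hfin : ∀ n, c * √(∑ i ∈ Finset.range n, h i ^ 2) ≤
      ‖W‖ * ‖(∑ i ∈ Finset.range n, h i • excess hsq b i)⁻‖ := fun n => by
    set s := √(∑ i ∈ Finset.range n, h i ^ 2) with hs
    have hs2 : s ^ 2 = ∑ i ∈ Finset.range n, h i ^ 2 :=
      Real.sq_sqrt (Finset.sum_nonneg fun i _ => sq_nonneg _)
    have hs0 : 0 ≤ s := Real.sqrt_nonneg _
    clear_value s
    rcases hs0.eq_or_lt with h0 | h0
    · rw [← h0, mul_zero]; positivity
    have h1 := hc n (fun i => h i / s) (by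
      simp_rw [div_pow]
      rw [← Finset.sum_div, ← hs2, div_self (by positivity)])
    have h2 : ∀ ω, W ω * max (-(∑ i ∈ Finset.range n, h i / s * (ε i ω - b i))) 0 =
        s⁻¹ * (W ω * max (-(∑ i ∈ Finset.range n, h i * (ε i ω - b i))) 0) := fun ω => by
      have h3 : ∑ i ∈ Finset.range n, h i / s * (ε i ω - b i) =
          s⁻¹ * ∑ i ∈ Finset.range n, h i * (ε i ω - b i) := by
        rw [Finset.mul_sum]
        exact Finset.sum_congr rfl fun i _ => by rw [div_eq_inv_mul, mul_assoc]
      rw [h3, ← mul_neg, ← mul_zero s⁻¹, ← mul_max_of_nonneg _ _ (inv_nonneg.2 h0.le)]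
      ring_nf
    simp_rw [h2] at h1
    rw [integral_const_mul, ← div_eq_inv_mul, le_div_iff₀ h0] at h1
    refine h1.trans (le_trans (le_of_eq ?_) (real_inner_le_norm W _))
    rw [inner_Lp]
    refine integral_congr_ae ?_
    have h4 := toLp_portfolio hsq b h 0 n
    rw [zero_smul, zero_add] at h4
    rw [← h4]
    filter_upwards [coeFn_negPart_Lp ((memLp_portfolio hsq b h 0 n).toLp _),
      (memLp_portfolio hsq b h 0 n).coeFn_toLp] with ω h5 h6
    rw [h5, h6, zero_add]
  have hnorm : Tendsto (fun n => √(∑ i ∈ Finset.range n, h i ^ 2)) atTop (𝓝 ‖h‖) := by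
    have h1 := (lp.hasSum_inner (𝕜 := ℝ) (G := fun _ : ℕ => ℝ) h h).tendsto_sum_nat
    rw [real_inner_self_eq_norm_sq] at h1
    have h2 := h1.sqrt
    rw [Real.sqrt_sq (norm_nonneg _)] at h2
    simpa [sq] using h2
  exact le_of_tendsto_of_tendsto' (hnorm.const_mul c)
    (((continuous_negPart.tendsto _).comp (hT h).tendsto_sum_nat).norm.const_mul _) hfin

theorem inner_gain_eq_zero (hsq : ∀ i, MemLp (ε i) 2 P) {T : ℓ²(ℕ, ℝ) →L[ℝ] Lp ℝ 2 P}
    (hT : ∀ h : ℓ²(ℕ, ℝ), HasSum (fun i => h i • excess hsq b i) (T h)) {Z : Lp ℝ 2 P}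
    (hZ : ∀ i, inner ℝ Z (excess hsq b i) = 0) (h : ℓ²(ℕ, ℝ)) : inner ℝ Z (T h) = 0 := by
  have h1 := (innerSL ℝ Z).hasSum (hT h)
  simp only [map_smul, innerSL_apply_apply, hZ, smul_zero] at h1
  exact h1.unique hasSum_zero

/-! ### Martingale measures as densities -/

theorem inner_bond (Z : Lp ℝ 2 P) : inner ℝ Z (bond P) = ∫ ω, Z ω ∂P := by
  rw [bond, inner_Lp_toLp]; simp

theorem integrable_and_integral_of_density {Q : Measure Ω} [SigmaFinite Q] (hQ : Q ≪ P)
    {Z G : Ω → ℝ} (hZ : MemLp Z 2 P) (hZQ : (fun ω => (Q.rnDeriv P ω).toReal) =ᵐ[P] Z)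
    (hG : MemLp G 2 P) :
    Integrable G Q ∧ ∫ ω, G ω ∂Q = inner ℝ (hZ.toLp Z) (hG.toLp G) := by
  have hZG : Integrable (fun ω => Z ω * G ω) P := hZ.integrable_mul hG
  have h : (fun ω => (Q.rnDeriv P ω).toReal • G ω) =ᵐ[P] fun ω => Z ω * G ω := by
    filter_upwards [hZQ] with ω hω
    rw [hω, smul_eq_mul]
  refine ⟨(integrable_rnDeriv_smul_iff hQ).1 (hZG.congr h.symm), ?_⟩
  rw [← integral_rnDeriv_smul hQ, integral_congr_ae h, inner_toLp]

/-- The density of a martingale measure is a positive normalised functional that vanishes on the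
excess returns. -/
theorem exists_density_of_mem_martingaleMeasures (hsq : ∀ i, MemLp (ε i) 2 P) {Q : Measure Ω}
    (hQ : Q ∈ martingaleMeasures P ε b) :
    ∃ Z : Lp ℝ 2 P, 0 ≤ Z ∧ inner ℝ Z (bond P) = 1 ∧ (∀ i, inner ℝ Z (excess hsq b i) = 0) ∧
      ∀ (G : Ω → ℝ) (hG : MemLp G 2 P),
        Integrable G Q ∧ ∫ ω, G ω ∂Q = inner ℝ Z (hG.toLp G) := by
  obtain ⟨hprob, hQP, hPQ, hZ, hε⟩ := hQ
  have key := fun (G : Ω → ℝ) (hG : MemLp G 2 P) =>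
    integrable_and_integral_of_density hQP hZ (ae_eq_refl _) hG
  refine ⟨hZ.toLp _, ?_, ?_, fun i => ?_, key⟩
  · rw [← Lp.coeFn_nonneg]
    filter_upwards [hZ.coeFn_toLp] with ω hω
    rw [hω]
    exact ENNReal.toReal_nonneg
  · have h := (key _ (memLp_const (1 : ℝ))).2
    exact h.symm.trans (by simp)
  · have h := (key _ ((hsq i).sub (memLp_const (b i)))).2
    refine Eq.trans h.symm ?_
    simp only [Pi.sub_apply]
    rw [integral_sub (hε i).1 (integrable_const _), (hε i).2]
    simp

/-- A positive functional that vanishes on the excess returns is, up to normalisation, a martingale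
measure. -/
theorem exists_martingaleMeasure_of_density (hsq : ∀ i, MemLp (ε i) 2 P) {Z : Lp ℝ 2 P}
    (hpos : ∀ᵐ ω ∂P, 0 < Z ω) (hZ : ∀ i, inner ℝ Z (excess hsq b i) = 0) :
    0 < inner ℝ Z (bond P) ∧ ∃ Q ∈ martingaleMeasures P ε b, ∀ (G : Ω → ℝ) (hG : MemLp G 2 P),
        ∫ ω, G ω ∂Q = inner ℝ Z (hG.toLp G) / inner ℝ Z (bond P) := by
  have hZint : Integrable (fun ω => Z ω) P := (Lp.memLp Z).integrable one_le_two
  set r := inner ℝ Z (bond P) with hr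
  have hr0 : 0 < r := by
    rw [hr, inner_bond, integral_pos_iff_support_of_nonneg_ae (hpos.mono fun ω h => h.le) hZint]
    have hsupp : Function.support (fun ω => Z ω) =ᵐ[P] Set.univ := by
      filter_upwards [hpos] with ω hω
      exact eq_true hω.ne'
    rw [measure_congr hsupp]
    simp
  refine ⟨hr0, ?_⟩
  set D : Ω → ℝ := fun ω => Z ω / r with hD
  have hDm : Measurable D := (Lp.stronglyMeasurable Z).measurable.div_const r
  have hDpos : ∀ᵐ ω ∂P, 0 < D ω := hpos.mono fun ω h => div_pos h hr0
  have hD2 : MemLp D 2 P := by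
    simpa only [hD, div_eq_inv_mul] using (Lp.memLp Z).const_mul r⁻¹
  have hDZ : hD2.toLp D = r⁻¹ • Z := by
    refine Lp.ext ?_
    filter_upwards [hD2.coeFn_toLp, Lp.coeFn_smul r⁻¹ Z] with ω h1 h2
    rw [h1, h2, Pi.smul_apply, smul_eq_mul]
    exact div_eq_inv_mul _ _
  set Q := P.withDensity fun ω => ENNReal.ofReal (D ω) with hQ
  have hmass : ∫⁻ ω, ENNReal.ofReal (D ω) ∂P = 1 := by
    rw [← ofReal_integral_eq_lintegral_ofReal (hD2.integrable one_le_two)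
      (hDpos.mono fun ω h => h.le), hD, integral_div, ← inner_bond, ← hr, div_self hr0.ne',
      ENNReal.ofReal_one]
  have hprob : IsProbabilityMeasure Q := ⟨by
    rw [hQ, withDensity_apply _ MeasurableSet.univ, setLIntegral_univ, hmass]⟩
  have hQP : Q ≪ P := withDensity_absolutelyContinuous _ _
  have hPQ : P ≪ Q := withDensity_absolutelyContinuous' hDm.ennreal_ofReal.aemeasurable
    (hDpos.mono fun ω h => (ENNReal.ofReal_pos.2 h).ne')
  have hdens : (fun ω => (Q.rnDeriv P ω).toReal) =ᵐ[P] D := by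
    filter_upwards [Measure.rnDeriv_withDensity P hDm.ennreal_ofReal, hDpos] with ω h1 h2
    rw [h1, ENNReal.toReal_ofReal h2.le]
  have key := fun (G : Ω → ℝ) (hG : MemLp G 2 P) =>
    integrable_and_integral_of_density hQP hD2 hdens hG
  have key' : ∀ (G : Ω → ℝ) (hG : MemLp G 2 P),
      ∫ ω, G ω ∂Q = inner ℝ Z (hG.toLp G) / r := fun G hG => by
    rw [(key G hG).2, hDZ, real_inner_smul_left, div_eq_inv_mul]
  refine ⟨Q, ⟨hprob, hQP, hPQ, (memLp_congr_ae hdens).2 hD2, fun i => ⟨(key _ (hsq i)).1, ?_⟩⟩,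
    key'⟩
  have h : ∫ ω, (ε i ω - b i) ∂Q = 0 :=
    (key' _ ((hsq i).sub (memLp_const (b i)))).trans (by
      have := hZ i
      rw [excess] at this
      exact (congrArg (· / r) this).trans (zero_div r))
  rw [integral_sub (key _ (hsq i)).1 (integrable_const _)] at h
  simp at h
  linarith

/-! ### The two inequalities -/

/-- Superreplication dominates every martingale expectation. -/
theorem integral_le_of_dominated (hsq : ∀ i, MemLp (ε i) 2 P) {T : ℓ²(ℕ, ℝ) →L[ℝ] Lp ℝ 2 P}
    (hT : ∀ h : ℓ²(ℕ, ℝ), HasSum (fun i => h i • excess hsq b i) (T h)) {G : Ω → ℝ}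
    (hG : MemLp G 2 P) {x : ℝ} (hx : ∃ h, hG.toLp G - x • bond P ≤ T h) {Q : Measure Ω}
    (hQ : Q ∈ martingaleMeasures P ε b) : ∫ ω, G ω ∂Q ≤ x := by
  obtain ⟨Z, hZ0, hZ1, hZε, hZG⟩ := exists_density_of_mem_martingaleMeasures hsq hQ
  obtain ⟨h, hh⟩ := hx
  have h1 := inner_nonneg_of_nonneg hZ0 (sub_nonneg.2 hh)
  rw [inner_sub_right, inner_sub_right, inner_gain_eq_zero hsq hT hZε, real_inner_smul_right,
    hZ1] at h1
  rw [(hZG G hG).2]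
  linarith

/-- Capital that does not suffice for superreplication lies below some martingale expectation. -/
theorem exists_lt_integral_of_not_dominated (hsq : ∀ i, MemLp (ε i) 2 P)
    {T : ℓ²(ℕ, ℝ) →L[ℝ] Lp ℝ 2 P}
    (hT : ∀ h : ℓ²(ℕ, ℝ), HasSum (fun i => h i • excess hsq b i) (T h))
    (hcl : IsClosed {y | ∃ h, y ≤ T h}) {W : Lp ℝ 2 P} (hW : ∀ᵐ ω ∂P, 0 < W ω)
    (hWε : ∀ i, inner ℝ W (excess hsq b i) = 0) {G : Ω → ℝ} (hG : MemLp G 2 P) {x : ℝ}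
    (hx : ¬∃ h, hG.toLp G - x • bond P ≤ T h) :
    ∃ Q ∈ martingaleMeasures P ε b, x < ∫ ω, G ω ∂Q := by
  obtain ⟨Z, hZ0, hZT, hZx⟩ := exists_separating_density hcl hx
  have hexc : ∀ i, excess hsq b i = T (lp.single 2 i 1) := fun i => by
    refine HasSum.unique ?_ (hT _)
    convert! hasSum_single (f := fun j => (lp.single 2 i (1 : ℝ) : ℓ²(ℕ, ℝ)) j • excess hsq b j) i
      fun j hj => by rw [lp.single_apply_ne _ _ _ hj, zero_smul]
    rw [lp.single_apply_self, one_smul]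
  set y := hG.toLp G - x • bond P with hy
  -- With this `δ` the perturbation by `δ • W` changes the pairing with `y` by at most half of
  -- `inner ℝ Z y`; the `+ 1` guards against a zero denominator.
  set δ := inner ℝ Z y / (2 * (|inner ℝ W y| + 1)) with hδ
  have hδ0 : 0 < δ := div_pos hZx (by positivity)
  have hpos : ∀ᵐ ω ∂P, 0 < (Z + δ • W) ω := by
    filter_upwards [Lp.coeFn_add Z (δ • W), Lp.coeFn_smul δ W, hW, (Lp.coeFn_nonneg Z).2 hZ0]
      with ω h1 h2 h3 h4
    rw [h1, Pi.add_apply, h2, Pi.smul_apply, smul_eq_mul]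
    exact add_pos_of_nonneg_of_pos h4 (mul_pos hδ0 h3)
  obtain ⟨hr0, Q, hQ, hQG⟩ := exists_martingaleMeasure_of_density (b := b) hsq hpos fun i => by
    rw [inner_add_left, real_inner_smul_left, hWε, hexc, hZT, mul_zero, add_zero]
  refine ⟨Q, hQ, ?_⟩
  have hmain : 0 < inner ℝ (Z + δ • W) y := by
    rw [inner_add_left, real_inner_smul_left]
    have h1 : δ * |inner ℝ W y| ≤ inner ℝ Z y / 2 := by
      rw [hδ, div_mul_eq_mul_div, div_le_iff₀ (by positivity)]
      nlinarith [abs_nonneg (inner ℝ W y)]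
    have h2 := mul_le_mul_of_nonneg_left (neg_abs_le (inner ℝ W y)) hδ0.le
    linarith
  rw [hQG G hG, lt_div_iff₀ hr0]
  rw [hy, inner_sub_right, real_inner_smul_right] at hmain
  linarith

end Market

end LargeMarket

/-! ### The duality theorem -/

theorem theorem1 {Ω : Type*} [MeasurableSpace Ω] (P : Measure Ω) [IsProbabilityMeasure P]
    (ε : ℕ → Ω → ℝ) (b : ℕ → ℝ)
    (hmeas : ∀ i, Measurable (ε i))
    (hindep : iIndepFun ε P)
    (hsq : ∀ i, MemLp (ε i) 2 P)
    (hmean : ∀ i, (∫ ω, ε i ω ∂P) = 0)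
    (hvar : ∀ i, (∫ ω, (ε i ω) ^ 2 ∂P) = 1)
    (hb : Memℓp b 2)
    (hup : ∀ i, 0 < P {ω | b i < ε i ω})
    (hdown : ∀ i, 0 < P {ω | ε i ω < b i})
    (hthird : (⨆ i, (∫⁻ ω, ‖ε i ω‖ₑ ^ 3 ∂P)) < (∞ : ℝ≥0∞))
    (G : Ω → ℝ) (hG : MemLp G 2 P) :
    (∀ Q ∈ LargeMarket.martingaleMeasures P ε b, Integrable G Q) ∧
      LargeMarket.superreplicationPrice P ε b G =
        ⨆ Q ∈ LargeMarket.martingaleMeasures P ε b, ((∫ ω, G ω ∂Q : ℝ) : EReal) := by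
  open LargeMarket in
  refine ⟨fun Q hQ => ?_, ?_⟩
  · obtain ⟨Z, -, -, -, hZ⟩ := exists_density_of_mem_martingaleMeasures hsq hQ
    exact (hZ G hG).1
  have hb2 : Summable fun i => b i ^ 2 := by
    have := hb.summable (by norm_num)
    simpa using this
  set C := (⨆ i, (∫⁻ ω, ‖ε i ω‖ₑ ^ 3 ∂P)) with hC
  have henorm : ∀ i, (fun ω => ‖|ε i ω| ^ 3‖ₑ) = fun ω => ‖ε i ω‖ₑ ^ 3 := fun i => by
    funext ω
    rw [enorm_pow, Real.enorm_abs]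
  have hint3 : ∀ i, Integrable (fun ω => |ε i ω| ^ 3) P := fun i =>
    ⟨((hmeas i).abs.pow_const 3).aestronglyMeasurable, by
      rw [hasFiniteIntegral_iff_enorm, henorm]
      exact (le_iSup (fun i => ∫⁻ ω, ‖ε i ω‖ₑ ^ 3 ∂P) i).trans_lt hthird⟩
  have hbound : ∀ i, ∫ ω, |ε i ω| ^ 3 ∂P ≤ max 1 C.toReal := fun i => by
    refine le_max_of_le_right ?_
    rw [integral_eq_lintegral_of_nonneg_ae (Eventually.of_forall fun ω => by positivity)
      (hint3 i).1]
    refine ENNReal.toReal_mono hthird.ne (le_trans (le_of_eq ?_)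
      (le_iSup (fun i => ∫⁻ ω, ‖ε i ω‖ₑ ^ 3 ∂P) i))
    refine lintegral_congr fun ω => ?_
    rw [← congrFun (henorm i) ω, Real.enorm_of_nonneg (by positivity)]
  obtain ⟨W, hW2, hWpos, hWinv, hWε⟩ := exists_pricing_density hmeas hindep hsq hmean hvar hb2
    hup hdown (le_max_left _ _) hint3 hbound
  obtain ⟨c, hc0, hc⟩ := exists_loss_bound hmeas hindep hsq hmean hvar hb2 hint3 hbound hW2 hWpos
    hWinv hWε
  obtain ⟨T, hT⟩ := exists_gain_operator hindep hsq hmean hvar hb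
  have hWae := hW2.coeFn_toLp
  have hco := gain_coercive hsq hT (W := hW2.toLp W) (c := c) fun n h hh =>
    (hc n h hh).trans_eq (integral_congr_ae (by
      filter_upwards [hWae] with ω hω
      rw [hω]))
  have hcl : IsClosed {y | ∃ h, y ≤ T h} := by
    refine isClosed_dominated T (c := c / (‖hW2.toLp W‖ + 1)) (by positivity) fun h => ?_
    rw [div_mul_eq_mul_div, div_le_iff₀ (by positivity)]
    nlinarith [hco h, norm_nonneg (T h)⁻]
  have hWpos' : ∀ᵐ ω ∂P, 0 < hW2.toLp W ω := by
    filter_upwards [hWae, hWpos] with ω h1 h2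
    rwa [h1]
  have hWε' : ∀ i, inner ℝ (hW2.toLp W) (excess hsq b i) = 0 := fun i => by
    rw [excess, inner_toLp]
    exact hWε i
  apply le_antisymm
  -- Comparing only with real `x` above the supremum also covers infinite values on either side: a
  -- failing `x` would lie strictly below some `E_Q G`, hence below the supremum.
  · refine EReal.le_of_forall_lt_iff_le.1 fun x hx => ?_
    by_contra hlt
    have hnot : ¬∃ h, hG.toLp G - x • bond P ≤ T h := fun hdom => hlt
      (sInf_le ⟨x, (superreplicating_nonempty_iff hsq hT hG x).2 hdom, rfl⟩)
    obtain ⟨Q, hQ, hxQ⟩ := exists_lt_integral_of_not_dominated hsq hT hcl hWpos' hWε' hG hnot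
    have h1 : ((∫ ω, G ω ∂Q : ℝ) : EReal) ≤
        ⨆ Q ∈ martingaleMeasures P ε b, ((∫ ω, G ω ∂Q : ℝ) : EReal) :=
      le_iSup₂ (f := fun Q (_ : Q ∈ martingaleMeasures P ε b) =>
        ((∫ ω, G ω ∂Q : ℝ) : EReal)) Q hQ
    exact absurd (h1.trans_lt hx) (not_lt.2 (EReal.coe_le_coe_iff.2 hxQ.le))
  · refine iSup₂_le fun Q hQ => le_sInf ?_
    rintro _ ⟨x, hx, rfl⟩
    exact EReal.coe_le_coe_iff.2 (integral_le_of_dominated hsq hT hG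
      ((superreplicating_nonempty_iff hsq hT hG x).1 hx) hQ)
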